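/- Let $n\ge 1$. All cubes $Q\subset\mathbb{R}^n$ are nondegenerate, with sides parallel to the axes; $|E|$ denotes Lebesgue measure and $f_Q=\frac1{|Q|}\int_Q f$. $\mathrm{BMO}(\mathbb{R}^n)$ is the space of locally integrable $f:\mathbb{R}^n\to\mathbb{C}$ with $\|f\|_{\mathrm{BMO}}=\sup_Q\frac1{|Q|}\int_Q|f-f_Q|\,dx<\infty$, and $\mathrm{CMO}(\mathbb{R}^n)$ is the closure of $C_c^\infty(\mathbb{R}^n)$ in $\mathrm{BMO}(\mathbb{R}^n)$ with respect to $\|\cdot\|_{\mathrm{BMO}}$. For a measurable function $g$ and $t>0$ let $$g^*(t)=\inf\{\alpha>0:\ |\{x\in\mathbb{R}^n:|g(x)|>\alpha\}|<t\},$$ and for $0<\lambda<1$ let $$\bar a_\lambda(f;Q)=\inf_{c\in\mathbb{C}}\big((f-c)\chi_Q\big)^*(\lambda|Q|).$$ **Theorem 3.3.** Let $0<\lambda\le\frac12$ and $f\in\mathrm{BMO}(\mathbb{R}^n)$. Then $f\in\mathrm{CMO}(\mathbb{R}^n)$ if and only if the following three conditions all hold: 1. $\displaystyle\lim_{r\to0^+}\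 \sup_{|Q|=r}\bar a_\lambda(f;Q)=0$; 2. $\displaystyle\lim_{r\to\infty}\ \sup_{|Q|=r}\bar a_\lambda(f;Q)=0$; 3. $\displaystyle\lim_{d\to\infty}\ \sup_{Q\cap[-d,d]^n=\emptyset}\bar a_\lambda(f;Q)=0$. -/

import Mathlib

open MeasureTheory Filter Topology
open scoped ENNReal

/-- A (nondegenerate, closed) cube in `ℝⁿ` with sides parallel to the coordinate axes. -/
def IsCube {n : ℕ} (Q : Set (Fin n → ℝ)) : Prop :=
  ∃ (a : Fin n → ℝ) (l : ℝ), 0 < l ∧ Q = Set.Icc a (fun i => a i + l)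

/-- The mean oscillation `𝒪(f; Q) = |Q|⁻¹ ∫_Q |f(x) - f_Q| dx`, as an extended nonnegative number,
where `f_Q` is the average of `f` over `Q`. -/
noncomputable def meanOscillation {n : ℕ} (f : (Fin n → ℝ) → ℂ) (Q : Set (Fin n → ℝ)) : ℝ≥0∞ :=
  ⨍⁻ x in Q, ‖f x - ⨍ y in Q, f y ∂volume‖ₑ ∂volume

/-- The BMO seminorm `sup_Q 𝒪(f; Q)`. -/
noncomputable def bmoSeminorm {n : ℕ} (f : (Fin n → ℝ) → ℂ) : ℝ≥0∞ :=
  ⨆ (Q : Set (Fin n → ℝ)) (_ : IsCube Q), meanOscillation f Q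

/-- `f ∈ BMO(ℝⁿ)`. -/
def MemBMO {n : ℕ} (f : (Fin n → ℝ) → ℂ) : Prop :=
  LocallyIntegrable f ∧ bmoSeminorm f < ⊤

/-- `f ∈ CMO(ℝⁿ)`: `f` lies in the closure of `C_c^∞(ℝⁿ)` in `BMO(ℝⁿ)`. -/
def MemCMO {n : ℕ} (f : (Fin n → ℝ) → ℂ) : Prop :=
  MemBMO f ∧ ∀ ε : ℝ≥0∞, 0 < ε →
    ∃ g : (Fin n → ℝ) → ℂ, ContDiff ℝ ((⊤ : ℕ∞) : WithTop ℕ∞) g ∧ HasCompactSupport g ∧ bmoSeminorm (f - g) < ε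

/-- The non-increasing rearrangement `f^*(t) = inf {α > 0 : |{x : |f(x)| > α}| < t}`
(equal to `∞` if no finite `α` qualifies, since `α = ∞` is allowed). -/
noncomputable def rearrangement {n : ℕ} (f : (Fin n → ℝ) → ℂ) (t : ℝ≥0∞) : ℝ≥0∞ :=
  sInf {α : ℝ≥0∞ | 0 < α ∧ volume {x | α < ‖f x‖ₑ} < t}

/-- The local mean oscillation `inf_{c ∈ ℂ} ((f - c) χ_Q)^*(λ |Q|)`. -/
noncomputable def localMeanOscillation {n : ℕ} (lam : ℝ) (f : (Fin n → ℝ) → ℂ)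
    (Q : Set (Fin n → ℝ)) : ℝ≥0∞ :=
  ⨅ c : ℂ, rearrangement (Q.indicator fun x => f x - c) (ENNReal.ofReal lam * volume Q)

/-! Both sides are compared with a third condition: the mean oscillation tends to zero along small,
large and distant cubes. For `f` in CMO it holds because it holds for test functions and the BMO
seminorm controls all cubes at once; Chebyshev's inequality then passes to the local mean
oscillation.

Conversely, as `lam ≤ 1/2`, small local mean oscillation on a cube makes `f` ε-close to a constant
on more than half of it. Suppose this holds on all subcubes of Q₀, with constant m on Q₀ itself. For
t ≥ ε the set S = {‖f - m‖ > t} fills less than half of Q₀, and shrinking Q₀ towards a density point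
of S yields a subcube exactly half filled by S. There `f` is nearly constant, yet ‖f - m‖ is above t
on one half and at most t on the other, so ‖f - m‖ is within 2ε of t on at least half of the
subcube. Vitali's lemma bounds |S| by 2·5ⁿ times the measure of that band in Q₀, and integrating in
t gives ∫ ‖f - m‖ ≤ Cε|Q₀| (`lintegral_enorm_sub_le_of_measurable`). Subcubes of small or distant
cubes are again small or distant. A large cube has other subcubes, but these lie in one fixed cube
P: the argument still works off P, and P contributes o(|Q₀|) since averages of a BMO function grow
at most logarithmically.

Finally, vanishing mean oscillation yields approximation (Uchiyama): subtract a constant, cut off at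
a large radius, mollify at a small scale. The slope of the cutoff beats the growth of the averages;
the mollification error is small in mean at one scale, hence at all larger ones. -/

/-! ### Half-filled subcubes and the John–Strömberg inequality. -/

open Metric in
theorem volume_real_closedBall_pi {n : ℕ} (z : Fin n → ℝ) {r : ℝ} (hr : 0 ≤ r) :
    volume.real (closedBall z r) = (2 * r) ^ n := by
  rw [measureReal_def, Real.volume_pi_closedBall z hr, ENNReal.toReal_ofReal (by positivity),
    Fintype.card_fin]

open Metric in
theorem volume_closedBall_pi_pos {n : ℕ} (z : Fin n → ℝ) {r : ℝ} (hr : 0 < r) :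
    0 < volume (closedBall z r) :=
  (isOpen_ball.measure_pos volume ⟨z, mem_ball_self hr⟩).trans_le
    (measure_mono ball_subset_closedBall)

open Metric in
theorem volume_closedBall_pi_ne_top {n : ℕ} (z : Fin n → ℝ) (r : ℝ) :
    volume (closedBall z r) ≠ ⊤ := (isCompact_closedBall z r).measure_lt_top.ne

open Metric in
/-- The cubes obtained from `closedBall z r` by the homotheties centred at a point `x` of it
form an increasing family. -/
theorem homothety_closedBall_mono {n : ℕ} {x z : Fin n → ℝ} {r : ℝ} (hx : x ∈ closedBall z r)
    {s t : ℝ} (hst : s ≤ t) :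
    closedBall (x + s • (z - x)) (s * r) ⊆ closedBall (x + t • (z - x)) (t * r) := by
  apply closedBall_subset_closedBall'
  have h1 : dist (x + s • (z - x)) (x + t • (z - x)) = (t - s) * ‖z - x‖ := by
    rw [dist_eq_norm]
    have : x + s • (z - x) - (x + t • (z - x)) = (s - t) • (z - x) := by
      rw [sub_smul]; abel
    rw [this, norm_smul, Real.norm_eq_abs, abs_sub_comm, abs_of_nonneg (by linarith)]
  have h2 : ‖z - x‖ ≤ r := by rw [← dist_eq_norm, dist_comm]; exact hx
  rw [h1]
  nlinarith

open Metric in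
/-- A point of density of `S` in a cube of which `S` fills less than a half lies in a subcube of
which `S` fills exactly a half. -/
theorem exists_closedBall_measure_inter_eq_half {n : ℕ} {S : Set (Fin n → ℝ)}
    {z x : Fin n → ℝ} {r : ℝ} (hr : 0 < r) (hx : x ∈ closedBall z r)
    (hd : Tendsto (fun s : ℝ => volume (S ∩ closedBall (x + s • (z - x)) (s * r)) /
      volume (closedBall (x + s • (z - x)) (s * r))) (𝓝[>] 0) (𝓝 1))
    (hhalf : volume (S ∩ closedBall z r) < volume (closedBall z r) / 2) :
    ∃ (w : Fin n → ℝ) (ρ : ℝ), 0 < ρ ∧ ρ ≤ r ∧ closedBall w ρ ⊆ closedBall z r ∧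
      x ∈ closedBall w ρ ∧ volume (S ∩ closedBall w ρ) = volume (closedBall w ρ) / 2 := by
  set Q : ℝ → Set (Fin n → ℝ) := fun s => closedBall (x + s • (z - x)) (s * r) with hQ
  have hQ1 : Q 1 = closedBall z r := by simp [hQ]
  have hfin : ∀ s, volume (Q s) ≠ ⊤ := fun s => volume_closedBall_pi_ne_top _ _
  have hfin' : ∀ s, volume (S ∩ Q s) ≠ ⊤ := fun s =>
    ((measure_mono Set.inter_subset_right).trans_lt (hfin s).lt_top).ne
  have hpos : ∀ s, 0 < s → 0 < volume (Q s) := fun s hs => volume_closedBall_pi_pos _ (by positivity)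
  have hV : ∀ s, 0 ≤ s → volume.real (Q s) = (2 * (s * r)) ^ n := fun s hs =>
    volume_real_closedBall_pi _ (by positivity)
  set G : ℝ → ℝ := fun s => volume.real (S ∩ Q s) with hG
  have hmono : ∀ s t, s ≤ t → Q s ⊆ Q t := fun s t hst => homothety_closedBall_mono hx hst
  have hGmono : ∀ s t, s ≤ t → G s ≤ G t := fun s t hst =>
    measureReal_mono (Set.inter_subset_inter_right _ (hmono s t hst)) (hfin' t)
  -- The increment of `G` is at most the volume of the shell `Q t \ Q s`, so `G` inherits continuity
  -- from the polynomial volume.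
  have hGdiff : ∀ s t, 0 ≤ s → s ≤ t →
      G t - G s ≤ (2 * (t * r)) ^ n - (2 * (s * r)) ^ n := by
    intro s t hs hst
    rw [← hV s hs, ← hV t (hs.trans hst)]
    have h1 : volume.real (Q t \ Q s) = volume.real (Q t) - volume.real (Q s) :=
      measureReal_sdiff (hmono s t hst) measurableSet_closedBall (hfin t)
    rw [← h1]
    have h2 : G t ≤ volume.real ((S ∩ Q s) ∪ (Q t \ Q s)) := by
      apply measureReal_mono
      · rintro y ⟨hy, hy'⟩
        by_cases h : y ∈ Q s
        · exact Or.inl ⟨hy, h⟩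
        · exact Or.inr ⟨hy', h⟩
      · exact ((measure_union_le _ _).trans_lt (ENNReal.add_lt_top.2 ⟨(hfin' s).lt_top,
          (measure_mono Set.sdiff_subset).trans_lt (hfin t).lt_top⟩)).ne
    have h3 := measureReal_union_le (μ := volume) (S ∩ Q s) (Q t \ Q s)
    simp only [hG] at h2 ⊢
    linarith
  have hPc : Continuous fun s : ℝ => (2 * (s * r)) ^ n := by fun_prop
  have hGc : ContinuousOn G (Set.Ici 0) := by
    rw [Metric.continuousOn_iff]
    intro b hb ε hε
    obtain ⟨δ, hδ, h⟩ := Metric.continuous_iff.1 hPc b ε hε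
    refine ⟨δ, hδ, fun a ha hab => ?_⟩
    have h' := h a hab
    rw [Real.dist_eq] at h' ⊢
    rcases le_total a b with hh | hh
    · have := hGdiff a b ha hh
      have h2 := hGmono a b hh
      rw [abs_lt] at h' ⊢
      constructor <;> linarith
    · have := hGdiff b a hb hh
      have h2 := hGmono b a hh
      rw [abs_lt] at h' ⊢
      constructor <;> linarith
  obtain ⟨s₀, hs₀, hs₀1, hs₀G⟩ : ∃ s₀ : ℝ, 0 < s₀ ∧ s₀ ≤ 1 ∧ (2 * (s₀ * r)) ^ n / 2 ≤ G s₀ := by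
    have h1 : ∀ᶠ s in 𝓝[>] (0 : ℝ), (2 : ℝ≥0∞)⁻¹ < volume (S ∩ Q s) / volume (Q s) :=
      hd.eventually (lt_mem_nhds (by simp))
    have h2 : ∀ᶠ s in 𝓝[>] (0 : ℝ), s ∈ Set.Ioc (0 : ℝ) 1 := Ioc_mem_nhdsGT one_pos
    obtain ⟨s, hs, hs'⟩ := (h1.and h2).exists
    refine ⟨s, hs'.1, hs'.2, ?_⟩
    rw [ENNReal.lt_div_iff_mul_lt (Or.inl (hpos s hs'.1).ne') (Or.inl (hfin s))] at hs
    have := ENNReal.toReal_mono (hfin' s) hs.le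
    rw [ENNReal.toReal_mul] at this
    simp only [ENNReal.toReal_inv, ENNReal.toReal_ofNat] at this
    rw [← hV s hs'.1.le, measureReal_def]
    simp only [hG, measureReal_def]
    linarith
  have h1G : G 1 ≤ (2 * (1 * r)) ^ n / 2 := by
    rw [← hV 1 zero_le_one]
    simp only [hG, measureReal_def, hQ1]
    have := ENNReal.toReal_mono (ENNReal.div_ne_top (volume_closedBall_pi_ne_top z r) (by simp))
      hhalf.le
    rwa [ENNReal.toReal_div, ENNReal.toReal_ofNat] at this
  have hcont : ContinuousOn (fun s => G s - (2 * (s * r)) ^ n / 2) (Set.Icc s₀ 1) :=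
    (hGc.mono fun s hs => hs₀.le.trans hs.1).sub (by fun_prop)
  obtain ⟨s, hs, hs0⟩ := intermediate_value_Icc' hs₀1 hcont
    (show (0 : ℝ) ∈ _ from ⟨by linarith, by linarith⟩)
  have hspos : 0 < s := hs₀.trans_le hs.1
  refine ⟨_, s * r, by positivity, by nlinarith [hs.2], hQ1 ▸ hmono s 1 hs.2, ?_, ?_⟩
  · rw [mem_closedBall, dist_eq_norm]
    have h2 : ‖z - x‖ ≤ r := by rw [← dist_eq_norm, dist_comm]; exact hx
    simp only [sub_add_cancel_left, norm_neg, norm_smul, Real.norm_eq_abs, abs_of_pos hspos]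
    gcongr
  · have h3 : G s = volume.real (Q s) / 2 := by rw [hV s hspos.le]; linarith
    rw [← ENNReal.toReal_eq_toReal_iff' (hfin' s) (ENNReal.div_ne_top (hfin s) (by simp)),
      ENNReal.toReal_div, ENNReal.toReal_ofNat]
    exact h3

/-- If `f` is `ε`-close to a constant `c` on more than half of `Q`, while `‖f - m‖ > t` on exactly
half of it, then `‖f - m‖` is `2ε`-close to `t` on at least half of `Q`. -/
theorem half_measure_le_measure_band {α : Type*} [MeasurableSpace α] {μ : Measure α} {f : α → ℂ}
    (hf : Measurable f) {Q : Set α} (hQt : μ Q ≠ ⊤) {c m : ℂ} {ε t : ℝ}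
    (hc : μ {x ∈ Q | ε < ‖f x - c‖} < μ Q / 2)
    (hm : μ ({x | t < ‖f x - m‖} ∩ Q) = μ Q / 2) :
    μ Q / 2 ≤ μ {x ∈ Q | t - 2 * ε < ‖f x - m‖ ∧ ‖f x - m‖ ≤ t + 2 * ε} := by
  have hSm : MeasurableSet {x | t < ‖f x - m‖} :=
    measurableSet_lt measurable_const (hf.sub_const m).norm
  have hGm : MeasurableSet {x | ε < ‖f x - c‖} :=
    measurableSet_lt measurable_const (hf.sub_const c).norm
  have hhalf : μ Q / 2 ≠ ⊤ := ENNReal.div_ne_top hQt (by simp)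
  have hbad : μ (Q ∩ {x | ε < ‖f x - c‖}) < μ Q / 2 := hc
  have hbadt : μ (Q ∩ {x | ε < ‖f x - c‖}) ≠ ⊤ := hbad.ne_top
  have hgood : μ Q / 2 < μ (Q \ {x | ε < ‖f x - c‖}) := by
    have h := measure_inter_add_sdiff (μ := μ) Q hGm
    by_contra! hcon
    have : μ Q < μ Q / 2 + μ Q / 2 := by
      conv_lhs => rw [← h]
      exact ENNReal.add_lt_add_of_lt_of_le (hcon.trans_lt hhalf.lt_top).ne hbad hcon
    rw [ENNReal.add_halves] at this
    exact lt_irrefl _ this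
  have hmc : μ (Q \ {x | t < ‖f x - m‖}) = μ Q / 2 := by
    have h := measure_inter_add_sdiff (μ := μ) Q hSm
    rw [Set.inter_comm, hm] at h
    nth_rewrite 2 [← ENNReal.add_halves (μ Q)] at h
    exact (ENNReal.add_right_inj hhalf).1 h
  -- The good set exceeds half of `Q`, while `{t < ‖f - m‖}` and its complement each take exactly
  -- half, so the good set meets both. Good values differ pairwise by at most 2ε, which places every
  -- good point in the band.
  obtain ⟨y, hyQ, hyc, hyt⟩ : ∃ y ∈ Q, ‖f y - c‖ ≤ ε ∧ t < ‖f y - m‖ := by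
    by_contra! hcon
    have : Q \ {x | ε < ‖f x - c‖} ⊆ Q \ {x | t < ‖f x - m‖} := by
      rintro y ⟨hy, hy'⟩
      simp only [Set.mem_ofPred_eq, not_lt] at hy'
      exact ⟨hy, by simpa using hcon y hy hy'⟩
    exact absurd ((measure_mono this).trans hmc.le) (not_le.2 hgood)
  obtain ⟨w, hwQ, hwc, hwt⟩ : ∃ w ∈ Q, ‖f w - c‖ ≤ ε ∧ ‖f w - m‖ ≤ t := by
    by_contra! hcon
    have : Q \ {x | ε < ‖f x - c‖} ⊆ {x | t < ‖f x - m‖} ∩ Q := by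
      rintro y ⟨hy, hy'⟩
      simp only [Set.mem_ofPred_eq, not_lt] at hy'
      exact ⟨hcon y hy hy', hy⟩
    exact absurd ((measure_mono this).trans hm.le) (not_le.2 hgood)
  have hclose : ∀ a b, ‖f a - c‖ ≤ ε → ‖f b - c‖ ≤ ε → ‖f a - m‖ ≤ ‖f b - m‖ + 2 * ε := by
    intro a b ha hb
    have h1 : f a - m = (f b - m) + (f a - c) - (f b - c) := by ring
    rw [h1]
    have h2 := norm_sub_le ((f b - m) + (f a - c)) (f b - c)
    have h3 := norm_add_le (f b - m) (f a - c)
    linarith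
  refine hgood.le.trans (measure_mono ?_)
  rintro a ⟨haQ, ha⟩
  simp only [Set.mem_ofPred_eq, not_lt] at ha
  have h1 := hclose y a hyc ha
  have h2 := hclose a w ha hwc
  exact ⟨haQ, by linarith, by linarith⟩

open Metric in
/-- Vitali covering bound: if every point of `A` lies in a cube inside `Q₀` of which `T` fills at
least a half, then `|A| ≤ 2·5ⁿ |T ∩ Q₀|`. -/
theorem measure_le_of_forall_mem_closedBall_half {n : ℕ} {A T : Set (Fin n → ℝ)}
    (hT : MeasurableSet T) {z : Fin n → ℝ} {r : ℝ}
    (h : ∀ x ∈ A, ∃ (w : Fin n → ℝ) (ρ : ℝ), 0 < ρ ∧ ρ ≤ r ∧ closedBall w ρ ⊆ closedBall z r ∧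
      x ∈ closedBall w ρ ∧ volume (closedBall w ρ) / 2 ≤ volume (T ∩ closedBall w ρ)) :
    volume A ≤ 2 * 5 ^ n * volume (T ∩ closedBall z r) := by
  choose! w ρ hρ hρr hsub hmem hhalf using h
  obtain ⟨u, huA, hdisj, hcov⟩ := Vitali.exists_disjoint_subfamily_covering_enlargement_closedBall
    A w ρ r hρr 5 (by norm_num)
  have hcount : u.Countable := hdisj.countable_of_nonempty_interior fun i hi =>
    ⟨w i, ball_subset_interior_closedBall (mem_ball_self (hρ i (huA hi)))⟩
  have hA : A ⊆ ⋃ b ∈ u, closedBall (w b) (5 * ρ b) := by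
    intro x hx
    obtain ⟨b, hb, hb'⟩ := hcov x hx
    exact Set.mem_biUnion hb (hb' (hmem x hx))
  calc volume A ≤ ∑' b : u, volume (closedBall (w b) (5 * ρ b)) :=
        (measure_mono hA).trans (measure_biUnion_le _ hcount _)
    _ ≤ ∑' b : u, 2 * 5 ^ n * volume (T ∩ closedBall (w b) (ρ b)) := by
        refine ENNReal.tsum_le_tsum fun b => ?_
        have hb := hρ b (huA b.2)
        have h5 : volume (closedBall (w b) (5 * ρ b)) = 5 ^ n * volume (closedBall (w b) (ρ b)) := by
          rw [Real.volume_pi_closedBall _ (by positivity), Real.volume_pi_closedBall _ hb.le,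
            Fintype.card_fin, show 2 * (5 * ρ b) = 5 * (2 * ρ b) by ring, mul_pow,
            ENNReal.ofReal_mul (by positivity), ENNReal.ofReal_pow (by norm_num)]
          simp
        rw [h5, mul_comm (2 : ℝ≥0∞), mul_assoc]
        gcongr
        have := hhalf b (huA b.2)
        rwa [ENNReal.div_le_iff_le_mul (by simp) (by simp), mul_comm] at this
    _ = 2 * 5 ^ n * volume (⋃ b ∈ u, T ∩ closedBall (w b) (ρ b)) := by
        rw [ENNReal.tsum_mul_left, measure_biUnion hcount
          (hdisj.mono fun i => Set.inter_subset_right)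
          fun b _ => hT.inter measurableSet_closedBall]
    _ ≤ 2 * 5 ^ n * volume (T ∩ closedBall z r) := by
        gcongr
        exact Set.iUnion₂_subset fun b hb => Set.inter_subset_inter_right _ (hsub b (huA hb))

/-- `f` is `ε`-close to a constant on more than half of `Q`. -/
def NearConst {n : ℕ} (f : (Fin n → ℝ) → ℂ) (ε : ℝ) (Q : Set (Fin n → ℝ)) (c : ℂ) : Prop :=
  volume {x ∈ Q | ε < ‖f x - c‖} < volume Q / 2

open Metric in
-- Almost every point of the superlevel set is a density point. Since `ε ≤ t`, the set fills less
-- than half of the big cube, so each such point has a half-filled subcube. That subcube is not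
-- inside `P`, as it contains a point off `P`; the band estimate applies to it, and Vitali sums up.
theorem measure_superlevel_diff_le {n : ℕ} {f : (Fin n → ℝ) → ℂ} (hf : Measurable f)
    {P : Set (Fin n → ℝ)} {z : Fin n → ℝ} {r : ℝ} (hr : 0 < r) {ε : ℝ}
    (hgood : ∀ w ρ, 0 < ρ → closedBall w ρ ⊆ closedBall z r → ¬ closedBall w ρ ⊆ P →
      ∃ c, NearConst f ε (closedBall w ρ) c)
    {m : ℂ} (hm : NearConst f ε (closedBall z r) m) {t : ℝ} (ht : ε ≤ t) :
    volume ({x ∈ closedBall z r | t < ‖f x - m‖} \ P) ≤ 2 * 5 ^ n *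
      volume {x ∈ closedBall z r | t - 2 * ε < ‖f x - m‖ ∧ ‖f x - m‖ ≤ t + 2 * ε} := by
  set S : Set (Fin n → ℝ) := {x | t < ‖f x - m‖} with hSdef
  have hS : MeasurableSet S := measurableSet_lt measurable_const (hf.sub_const m).norm
  set T : Set (Fin n → ℝ) := {x | t - 2 * ε < ‖f x - m‖ ∧ ‖f x - m‖ ≤ t + 2 * ε} with hTdef
  have hT : MeasurableSet T := (measurableSet_lt measurable_const (hf.sub_const m).norm).inter
    (measurableSet_le (hf.sub_const m).norm measurable_const)
  -- The parameter 1 admits balls that merely contain `x`; the homothetic cubes used here are not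
  -- centred at `x`.
  have hdens := IsUnifLocDoublingMeasure.ae_tendsto_measure_inter_div
    (volume : Measure (Fin n → ℝ)) S 1
  rw [ae_restrict_iff' hS] at hdens
  set D : Set (Fin n → ℝ) := {x | x ∈ closedBall z r → x ∈ S → Tendsto (fun s : ℝ =>
    volume (S ∩ closedBall (x + s • (z - x)) (s * r)) /
      volume (closedBall (x + s • (z - x)) (s * r))) (𝓝[>] 0) (𝓝 1)} with hD
  have hDae : ∀ᵐ x, x ∈ D := by
    filter_upwards [hdens] with x hx hxz hxS
    refine hx hxS (fun s : ℝ => x + s • (z - x)) (fun s => s * r) ?_ ?_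
    · refine tendsto_nhdsWithin_iff.2 ⟨?_, ?_⟩
      · have : Tendsto (fun s : ℝ => s * r) (𝓝 0) (𝓝 (0 * r)) := by
          apply Continuous.tendsto; fun_prop
        rw [zero_mul] at this
        exact this.mono_left nhdsWithin_le_nhds
      · filter_upwards [self_mem_nhdsWithin] with s hs using mul_pos hs hr
    · filter_upwards [self_mem_nhdsWithin] with s hs
      rw [mem_closedBall, dist_eq_norm]
      have h2 : ‖z - x‖ ≤ r := by rw [← dist_eq_norm, dist_comm]; exact hxz
      simp only [sub_add_cancel_left, norm_neg, norm_smul, Real.norm_eq_abs,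
        abs_of_pos (show (0 : ℝ) < s from hs), one_mul]
      exact mul_le_mul_of_nonneg_left h2 (le_of_lt hs)
  have h0 : volume ({x ∈ closedBall z r | t < ‖f x - m‖} \ P) =
      volume (({x ∈ closedBall z r | t < ‖f x - m‖} \ P) ∩ D) := by
    apply measure_congr
    filter_upwards [hDae] with x hx
    refine propext ⟨fun h => ⟨h, hx⟩, fun h => h.1⟩
  rw [h0]
  have hcomm : {x ∈ closedBall z r | t - 2 * ε < ‖f x - m‖ ∧ ‖f x - m‖ ≤ t + 2 * ε} =
      T ∩ closedBall z r := by
    ext x; simp [hTdef, and_comm]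
  rw [hcomm]
  refine measure_le_of_forall_mem_closedBall_half hT ?_
  rintro x ⟨⟨⟨hxz, hxt⟩, hxP⟩, hxD⟩
  have hhalf : volume (S ∩ closedBall z r) < volume (closedBall z r) / 2 := by
    refine lt_of_le_of_lt (measure_mono ?_) hm
    rintro y ⟨hy, hy'⟩
    exact ⟨hy', ht.trans_lt hy⟩
  obtain ⟨w, ρ, hρ, hρr, hsub, hmem, heq⟩ :=
    exists_closedBall_measure_inter_eq_half hr hxz (hxD hxz hxt) hhalf
  obtain ⟨c, hc⟩ := hgood w ρ hρ hsub fun h => hxP (h hmem)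
  refine ⟨w, ρ, hρ, hρr, hsub, hmem, ?_⟩
  have := half_measure_le_measure_band hf
    (volume_closedBall_pi_ne_top w ρ) hc heq
  refine this.trans (measure_mono ?_)
  rintro y ⟨hy, hy'⟩
  exact ⟨hy', hy⟩

open Metric in
/-- John–Strömberg inequality: if `f` is `ε`-close to a constant on more than half of each subcube
of `Q₀` not contained in `P`, then `∫_{Q₀ \ P} |f - m| ≤ C ε |Q₀|`. -/
theorem lintegral_enorm_sub_le_of_measurable {n : ℕ} {f : (Fin n → ℝ) → ℂ} (hf : Measurable f)
    {P : Set (Fin n → ℝ)}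
    {z : Fin n → ℝ} {r : ℝ} (hr : 0 < r) {ε : ℝ} (hε : 0 < ε)
    (hgood : ∀ w ρ, 0 < ρ → closedBall w ρ ⊆ closedBall z r → ¬ closedBall w ρ ⊆ P →
      ∃ c, NearConst f ε (closedBall w ρ) c)
    {m : ℂ} (hm : NearConst f ε (closedBall z r) m) :
    ∫⁻ x in closedBall z r \ P, ‖f x - m‖ₑ ≤
      ENNReal.ofReal ((8 * 5 ^ n + 1) * ε) * volume (closedBall z r) := by
  set B := closedBall z r with hB
  have hBm : MeasurableSet B := measurableSet_closedBall
  set u : (Fin n → ℝ) → ℝ := fun x => ‖f x - m‖ with hu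
  have hum : Measurable u := (hf.sub_const m).norm
  have h1 : ∫⁻ x in B \ P, ‖f x - m‖ₑ =
      ∫⁻ t in Set.Ioi (0 : ℝ), volume.restrict (B \ P) {x | t < u x} := by
    rw [← lintegral_eq_lintegral_meas_lt _ (Eventually.of_forall fun x => norm_nonneg _)
      hum.aemeasurable]
    simp only [ofReal_norm]
  have hres : ∀ t, volume.restrict (B \ P) {x | t < u x} = volume ({x ∈ B | t < u x} \ P) := by
    intro t
    rw [Measure.restrict_apply (measurableSet_lt measurable_const hum)]
    congr 1
    ext x
    simp only [Set.mem_inter_iff, Set.mem_ofPred_eq, Set.mem_sdiff]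
    tauto
  have h2 : ∫⁻ t in Set.Ioc (0 : ℝ) ε, volume.restrict (B \ P) {x | t < u x} ≤
      ENNReal.ofReal ε * volume B := by
    calc _ ≤ ∫⁻ t in Set.Ioc (0 : ℝ) ε, volume B := by
          refine lintegral_mono fun t => ?_
          rw [hres]
          exact measure_mono fun x hx => hx.1.1
      _ = _ := by simp [mul_comm]
  have hTm : MeasurableSet {p : ℝ × (Fin n → ℝ) | p.1 - 2 * ε < u p.2 ∧ u p.2 ≤ p.1 + 2 * ε} :=
    by measurability
  -- By Tonelli, each `x` lies in the band for levels t in an interval of length 4ε. This gives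
  -- 2·5ⁿ·4ε; the levels up to ε give the remaining `+ 1` in the constant.
  have h3 : ∫⁻ t in Set.Ioi ε, volume.restrict (B \ P) {x | t < u x} ≤
      2 * 5 ^ n * (ENNReal.ofReal (4 * ε) * volume B) := by
    calc _ ≤ ∫⁻ t in Set.Ioi ε,
          2 * 5 ^ n * volume {x ∈ B | t - 2 * ε < u x ∧ u x ≤ t + 2 * ε} := by
          refine setLIntegral_mono' measurableSet_Ioi fun t ht => ?_
          rw [hres]
          exact measure_superlevel_diff_le hf hr hgood hm (le_of_lt ht)
      _ ≤ ∫⁻ t, 2 * 5 ^ n * volume {x ∈ B | t - 2 * ε < u x ∧ u x ≤ t + 2 * ε} :=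
          setLIntegral_le_lintegral _ _
      _ = 2 * 5 ^ n * ∫⁻ t, volume {x ∈ B | t - 2 * ε < u x ∧ u x ≤ t + 2 * ε} := by
          rw [lintegral_const_mul' _ _ (by finiteness)]
      _ = 2 * 5 ^ n * ∫⁻ t, ∫⁻ x in B,
            Set.indicator {p : ℝ × (Fin n → ℝ) | p.1 - 2 * ε < u p.2 ∧ u p.2 ≤ p.1 + 2 * ε}
              1 (t, x) := by
          congr 1
          refine lintegral_congr fun t => ?_
          have : ∀ x, Set.indicator
              {p : ℝ × (Fin n → ℝ) | p.1 - 2 * ε < u p.2 ∧ u p.2 ≤ p.1 + 2 * ε}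
              (1 : ℝ × (Fin n → ℝ) → ℝ≥0∞) (t, x) =
              Set.indicator {x | t - 2 * ε < u x ∧ u x ≤ t + 2 * ε} 1 x := fun x => by
            simp [Set.indicator_apply]
          simp_rw [this]
          have hm' : MeasurableSet {x | t - 2 * ε < u x ∧ u x ≤ t + 2 * ε} :=
            by measurability
          rw [lintegral_indicator_one hm', Measure.restrict_apply hm', Set.inter_comm]
          rfl
      _ = 2 * 5 ^ n * ∫⁻ x in B, ∫⁻ t,
            Set.indicator {p : ℝ × (Fin n → ℝ) | p.1 - 2 * ε < u p.2 ∧ u p.2 ≤ p.1 + 2 * ε}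
              1 (t, x) := by
          rw [lintegral_lintegral_swap]
          exact (measurable_one.indicator hTm).aemeasurable
      _ = 2 * 5 ^ n * ∫⁻ x in B, ENNReal.ofReal (4 * ε) := by
          congr 1
          refine lintegral_congr fun x => ?_
          have : ∀ t, Set.indicator
              {p : ℝ × (Fin n → ℝ) | p.1 - 2 * ε < u p.2 ∧ u p.2 ≤ p.1 + 2 * ε}
              (1 : ℝ × (Fin n → ℝ) → ℝ≥0∞) (t, x) =
              Set.indicator (Set.Ico (u x - 2 * ε) (u x + 2 * ε)) 1 t := fun t => by
            simp only [Set.indicator_apply, Set.mem_ofPred_eq, Set.mem_Ico]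
            congr 1
            simp only [eq_iff_iff]
            constructor <;> rintro ⟨h, h'⟩ <;> constructor <;> linarith
          simp_rw [this]
          rw [lintegral_indicator_one measurableSet_Ico, Real.volume_Ico]
          congr 1; ring
      _ = _ := by simp
  rw [h1, ← Set.Ioc_union_Ioi_eq_Ioi hε.le]
  refine (lintegral_union_le _ _ _).trans ((add_le_add h2 h3).trans (le_of_eq ?_))
  rw [← mul_assoc, ← add_mul]
  congr 1
  rw [show (2 : ℝ≥0∞) * 5 ^ n = ENNReal.ofReal (2 * 5 ^ n) by
    rw [ENNReal.ofReal_mul (by norm_num), ENNReal.ofReal_pow (by norm_num)]; simp,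
    ← ENNReal.ofReal_mul (by positivity), ← ENNReal.ofReal_add (by positivity) (by positivity)]
  congr 1; ring

open Metric in
theorem NearConst.congr_ae {n : ℕ} {f g : (Fin n → ℝ) → ℂ} (h : f =ᵐ[volume] g) {ε : ℝ}
    {Q : Set (Fin n → ℝ)} {c : ℂ} (hf : NearConst f ε Q c) : NearConst g ε Q c := by
  unfold NearConst at *
  have : volume {x ∈ Q | ε < ‖g x - c‖} = volume {x ∈ Q | ε < ‖f x - c‖} := by
    apply measure_congr
    filter_upwards [h] with x hx
    change (_ ∧ _) = (_ ∧ _)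
    rw [hx]
  rwa [this]

open Metric in
theorem lintegral_enorm_sub_le {n : ℕ} {f : (Fin n → ℝ) → ℂ} (hf : AEStronglyMeasurable f)
    {P : Set (Fin n → ℝ)}
    {z : Fin n → ℝ} {r : ℝ} (hr : 0 < r) {ε : ℝ} (hε : 0 < ε)
    (hgood : ∀ w ρ, 0 < ρ → closedBall w ρ ⊆ closedBall z r → ¬ closedBall w ρ ⊆ P →
      ∃ c, NearConst f ε (closedBall w ρ) c)
    {m : ℂ} (hm : NearConst f ε (closedBall z r) m) :
    ∫⁻ x in closedBall z r \ P, ‖f x - m‖ₑ ≤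
      ENNReal.ofReal ((8 * 5 ^ n + 1) * ε) * volume (closedBall z r) := by
  have hae := hf.ae_eq_mk
  have h := lintegral_enorm_sub_le_of_measurable hf.stronglyMeasurable_mk.measurable hr hε
    (fun w ρ h1 h2 h3 => (hgood w ρ h1 h2 h3).imp fun c hc => hc.congr_ae hae) (hm.congr_ae hae)
  refine le_trans (le_of_eq ?_) h
  refine lintegral_congr_ae (ae_restrict_of_ae ?_)
  filter_upwards [hae] with x hx
  rw [hx]

/-! ### Averages, mean deviation and mean oscillation over cubes. -/

open Metric in
noncomputable def cubeAvg {n : ℕ} (f : (Fin n → ℝ) → ℂ) (z : Fin n → ℝ) (r : ℝ) : ℂ :=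
  ⨍ x in closedBall z r, f x

open Metric in
/-- The mean deviation of `f` from the constant `c` over the cube `closedBall z r`. -/
noncomputable def cubeDev {n : ℕ} (f : (Fin n → ℝ) → ℂ) (c : ℂ) (z : Fin n → ℝ) (r : ℝ) : ℝ :=
  ⨍ x in closedBall z r, ‖f x - c‖

noncomputable def cubeOsc {n : ℕ} (f : (Fin n → ℝ) → ℂ) (z : Fin n → ℝ) (r : ℝ) : ℝ :=
  cubeDev f (cubeAvg f z r) z r

open Metric in
-- The norm on `Fin n → ℝ` is the sup norm, so covering and density theorems for metric balls apply
-- directly to cubes.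
theorem isCube_iff_exists_closedBall {n : ℕ} {Q : Set (Fin n → ℝ)} :
    IsCube Q ↔ ∃ (z : Fin n → ℝ) (r : ℝ), 0 < r ∧ Q = closedBall z r := by
  have key : ∀ (z : Fin n → ℝ) (r : ℝ), 0 ≤ r →
      closedBall z r = Set.Icc (fun i => z i - r) (fun i => z i + r) := by
    intro z r hr
    rw [closedBall_pi z hr, ← Set.pi_univ_Icc]
    simp only [Real.closedBall_eq_Icc]
  constructor
  · rintro ⟨a, l, hl, rfl⟩
    refine ⟨fun i => a i + l / 2, l / 2, by positivity, ?_⟩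
    rw [key _ _ (by positivity)]
    congr 1 <;> ext i <;> ring
  · rintro ⟨z, r, hr, rfl⟩
    refine ⟨fun i => z i - r, 2 * r, by positivity, ?_⟩
    rw [key z r hr.le]
    congr 1
    ext i; ring

open Metric in
theorem cubeDev_eq {n : ℕ} (f : (Fin n → ℝ) → ℂ) (c : ℂ) (z : Fin n → ℝ) {r : ℝ} (hr : 0 ≤ r) :
    cubeDev f c z r = ((2 * r) ^ n)⁻¹ * ∫ x in closedBall z r, ‖f x - c‖ := by
  rw [cubeDev, setAverage_eq, volume_real_closedBall_pi z hr, smul_eq_mul]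

open Metric in
theorem cubeAvg_eq {n : ℕ} (f : (Fin n → ℝ) → ℂ) (z : Fin n → ℝ) {r : ℝ} (hr : 0 ≤ r) :
    cubeAvg f z r = ((2 * r) ^ n)⁻¹ • ∫ x in closedBall z r, f x := by
  rw [cubeAvg, setAverage_eq, volume_real_closedBall_pi z hr]

open Metric in
theorem setIntegral_eq_mul_cubeDev {n : ℕ} (f : (Fin n → ℝ) → ℂ) (c : ℂ) (z : Fin n → ℝ) {r : ℝ}
    (hr : 0 < r) : ∫ x in closedBall z r, ‖f x - c‖ = (2 * r) ^ n * cubeDev f c z r := by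
  rw [cubeDev_eq f c z hr.le, mul_inv_cancel_left₀ (by positivity)]

theorem cubeDev_nonneg {n : ℕ} (f : (Fin n → ℝ) → ℂ) (c : ℂ) (z : Fin n → ℝ) (r : ℝ) :
    0 ≤ cubeDev f c z r := by
  rw [cubeDev, setAverage_eq]
  exact smul_nonneg (by positivity) (integral_nonneg fun x => norm_nonneg _)

theorem cubeOsc_nonneg {n : ℕ} (f : (Fin n → ℝ) → ℂ) (z : Fin n → ℝ) (r : ℝ) :
    0 ≤ cubeOsc f z r := cubeDev_nonneg _ _ _ _

open Metric in
theorem MeasureTheory.LocallyIntegrable.integrableOn_closedBall_pi {n : ℕ}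
    {f : (Fin n → ℝ) → ℂ} (hf : LocallyIntegrable f) (z : Fin n → ℝ) (r : ℝ) :
    IntegrableOn f (closedBall z r) := hf.integrableOn_isCompact (isCompact_closedBall z r)

open Metric in
theorem MeasureTheory.LocallyIntegrable.integrableOn_norm_sub {n : ℕ}
    {f : (Fin n → ℝ) → ℂ} (hf : LocallyIntegrable f) (c : ℂ) (z : Fin n → ℝ) (r : ℝ) :
    IntegrableOn (fun x => ‖f x - c‖) (closedBall z r) :=
  ((hf.integrableOn_closedBall_pi z r).sub
    (integrableOn_const (volume_closedBall_pi_ne_top z r))).norm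

open Metric in
theorem cubeDev_le_of_forall {n : ℕ} {f : (Fin n → ℝ) → ℂ} (hf : LocallyIntegrable f) {c : ℂ}
    {z : Fin n → ℝ} {r : ℝ} (hr : 0 < r) {g : (Fin n → ℝ) → ℝ}
    (hg : IntegrableOn g (closedBall z r)) (h : ∀ x ∈ closedBall z r, ‖f x - c‖ ≤ g x) :
    cubeDev f c z r ≤ ((2 * r) ^ n)⁻¹ * ∫ x in closedBall z r, g x := by
  rw [cubeDev_eq f c z hr.le]
  exact mul_le_mul_of_nonneg_left
    (setIntegral_mono_on (hf.integrableOn_norm_sub c z r) hg measurableSet_closedBall h)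
    (by positivity)

open Metric in
theorem inv_mul_setIntegral_const {n : ℕ} (z : Fin n → ℝ) {r : ℝ} (hr : 0 < r) (K : ℝ) :
    ((2 * r) ^ n)⁻¹ * ∫ _ in closedBall z r, K = K := by
  rw [setIntegral_const, volume_real_closedBall_pi z hr.le, smul_eq_mul,
    inv_mul_cancel_left₀ (by positivity)]

theorem cubeDev_le_of_forall_le {n : ℕ} {f : (Fin n → ℝ) → ℂ} (hf : LocallyIntegrable f) {c : ℂ}
    {z : Fin n → ℝ} {r : ℝ} (hr : 0 < r) {K : ℝ}
    (h : ∀ x ∈ Metric.closedBall z r, ‖f x - c‖ ≤ K) : cubeDev f c z r ≤ K :=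
  (cubeDev_le_of_forall hf hr (integrableOn_const (volume_closedBall_pi_ne_top z r)) h).trans
    (inv_mul_setIntegral_const z hr K).le

/-- If `‖f - c‖ ≤ A ‖g - d‖ + K` on a cube then the mean deviations satisfy the same inequality. -/
theorem cubeDev_le_mul_cubeDev_add {n : ℕ} {f g : (Fin n → ℝ) → ℂ} (hf : LocallyIntegrable f)
    (hg : LocallyIntegrable g) {c d : ℂ} {z : Fin n → ℝ} {r : ℝ} (hr : 0 < r) {A K : ℝ}
    (h : ∀ x ∈ Metric.closedBall z r, ‖f x - c‖ ≤ A * ‖g x - d‖ + K) :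
    cubeDev f c z r ≤ A * cubeDev g d z r + K := by
  have h1 : IntegrableOn (fun x => A * ‖g x - d‖) (Metric.closedBall z r) :=
    (hg.integrableOn_norm_sub d z r).const_mul A
  have h2 : IntegrableOn (fun _ : Fin n → ℝ => K) (Metric.closedBall z r) :=
    integrableOn_const (volume_closedBall_pi_ne_top z r)
  refine (cubeDev_le_of_forall hf hr (h1.add h2) h).trans (le_of_eq ?_)
  change ((2 * r) ^ n)⁻¹ * ∫ x in Metric.closedBall z r, (A * ‖g x - d‖ + K) = _
  rw [integral_add h1 h2, integral_const_mul, mul_add, inv_mul_setIntegral_const z hr,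
    setIntegral_eq_mul_cubeDev g d z hr]
  have : ((2 * r) ^ n) ≠ 0 := by positivity
  field_simp

theorem cubeDev_add_le {n : ℕ} {f g : (Fin n → ℝ) → ℂ} (hf : LocallyIntegrable f)
    (hg : LocallyIntegrable g) (c d : ℂ) (z : Fin n → ℝ) {r : ℝ} (hr : 0 < r) :
    cubeDev (f + g) (c + d) z r ≤ cubeDev f c z r + cubeDev g d z r := by
  have h1 := hf.integrableOn_norm_sub c z r
  have h2 := hg.integrableOn_norm_sub d z r
  refine (cubeDev_le_of_forall (hf.add hg) hr (h1.add h2) fun x _ => ?_).trans (le_of_eq ?_)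
  · simp only [Pi.add_apply]
    rw [show f x + g x - (c + d) = (f x - c) + (g x - d) by ring]
    exact norm_add_le _ _
  · change ((2 * r) ^ n)⁻¹ * ∫ x in Metric.closedBall z r, (‖f x - c‖ + ‖g x - d‖) = _
    rw [integral_add h1 h2, mul_add, cubeDev_eq _ _ _ hr.le, cubeDev_eq _ _ _ hr.le]

theorem cubeDev_neg {n : ℕ} (f : (Fin n → ℝ) → ℂ) (c : ℂ) (z : Fin n → ℝ) (r : ℝ) :
    cubeDev (-f) (-c) z r = cubeDev f c z r := by
  simp only [cubeDev, Pi.neg_apply]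
  simp_rw [← neg_sub', norm_neg]

theorem cubeDev_sub_le {n : ℕ} {f g : (Fin n → ℝ) → ℂ} (hf : LocallyIntegrable f)
    (hg : LocallyIntegrable g) (c d : ℂ) (z : Fin n → ℝ) {r : ℝ} (hr : 0 < r) :
    cubeDev (f - g) (c - d) z r ≤ cubeDev f c z r + cubeDev g d z r := by
  rw [sub_eq_add_neg, sub_eq_add_neg, ← cubeDev_neg g]
  exact cubeDev_add_le hf hg.neg _ _ z hr

theorem cubeDev_le_cubeDev_add_norm {n : ℕ} {f : (Fin n → ℝ) → ℂ} (hf : LocallyIntegrable f)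
    (c d : ℂ) (z : Fin n → ℝ) {r : ℝ} (hr : 0 < r) :
    cubeDev f c z r ≤ cubeDev f d z r + ‖d - c‖ := by
  have := cubeDev_le_mul_cubeDev_add hf hf (c := c) (d := d) (z := z) hr (A := 1) (K := ‖d - c‖)
    fun x _ => by
      rw [one_mul, show f x - c = (f x - d) + (d - c) by ring]
      exact norm_add_le _ _
  rwa [one_mul] at this

open Metric in
theorem norm_cubeAvg_sub_le {n : ℕ} {f : (Fin n → ℝ) → ℂ} (hf : LocallyIntegrable f)
    (c : ℂ) (z : Fin n → ℝ) {r : ℝ} (hr : 0 < r) : ‖cubeAvg f z r - c‖ ≤ cubeDev f c z r := by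
  have hi := hf.integrableOn_closedBall_pi z r
  have hc : IntegrableOn (fun _ : Fin n → ℝ => c) (closedBall z r) :=
    integrableOn_const (volume_closedBall_pi_ne_top z r)
  have h1 : cubeAvg f z r - c = ((2 * r) ^ n)⁻¹ • ∫ x in closedBall z r, (f x - c) := by
    rw [integral_sub hi hc, smul_sub, cubeAvg_eq f z hr.le, setIntegral_const,
      volume_real_closedBall_pi z hr.le, smul_smul, inv_mul_cancel₀ (by positivity), one_smul]
  rw [h1, norm_smul, Real.norm_of_nonneg (by positivity), cubeDev_eq f c z hr.le]
  gcongr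
  exact norm_integral_le_integral_norm _

/-- Replacing `c` by the average costs at most one further mean deviation. Hence oscillation may be
tested with any convenient constant. -/
theorem cubeOsc_le_two_mul_cubeDev {n : ℕ} {f : (Fin n → ℝ) → ℂ} (hf : LocallyIntegrable f)
    (c : ℂ) (z : Fin n → ℝ) {r : ℝ} (hr : 0 < r) : cubeOsc f z r ≤ 2 * cubeDev f c z r := by
  have h1 := cubeDev_le_cubeDev_add_norm hf (cubeAvg f z r) c z hr
  have h2 := norm_cubeAvg_sub_le hf c z hr
  rw [norm_sub_rev] at h2
  unfold cubeOsc
  linarith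

open Metric in
theorem cubeDev_le_of_subset {n : ℕ} {f : (Fin n → ℝ) → ℂ} (hf : LocallyIntegrable f)
    (c : ℂ) {z w : Fin n → ℝ} {r s : ℝ} (hr : 0 < r) (hs : 0 < s)
    (h : closedBall z r ⊆ closedBall w s) :
    cubeDev f c z r ≤ (s / r) ^ n * cubeDev f c w s := by
  have h1 : ∫ x in closedBall z r, ‖f x - c‖ ≤ ∫ x in closedBall w s, ‖f x - c‖ :=
    setIntegral_mono_set (hf.integrableOn_norm_sub c w s)
      (Eventually.of_forall fun x => norm_nonneg _) h.eventuallyLE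
  rw [setIntegral_eq_mul_cubeDev _ _ _ hr, setIntegral_eq_mul_cubeDev _ _ _ hs] at h1
  rw [div_pow, div_mul_eq_mul_div, le_div_iff₀ (by positivity)]
  rw [mul_pow, mul_pow, mul_assoc, mul_assoc] at h1
  have := le_of_mul_le_mul_left h1 (by positivity)
  linarith

theorem cubeOsc_add_le {n : ℕ} {f g : (Fin n → ℝ) → ℂ} (hf : LocallyIntegrable f)
    (hg : LocallyIntegrable g) (z : Fin n → ℝ) {r : ℝ} (hr : 0 < r) :
    cubeOsc (f + g) z r ≤ cubeOsc f z r + cubeOsc g z r := by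
  have : cubeAvg (f + g) z r = cubeAvg f z r + cubeAvg g z r := by
    rw [cubeAvg_eq _ _ hr.le, cubeAvg_eq _ _ hr.le, cubeAvg_eq _ _ hr.le, ← smul_add]
    congr 1
    exact integral_add (hf.integrableOn_closedBall_pi z r) (hg.integrableOn_closedBall_pi z r)
  unfold cubeOsc
  rw [this]
  exact cubeDev_add_le hf hg _ _ z hr

theorem cubeOsc_neg {n : ℕ} (f : (Fin n → ℝ) → ℂ) (z : Fin n → ℝ) {r : ℝ} (hr : 0 < r) :
    cubeOsc (-f) z r = cubeOsc f z r := by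
  have : cubeAvg (-f) z r = -cubeAvg f z r := by
    rw [cubeAvg_eq _ _ hr.le, cubeAvg_eq _ _ hr.le, ← smul_neg, ← integral_neg]
    rfl
  rw [cubeOsc, this, cubeDev_neg, cubeOsc]

theorem cubeOsc_sub_le {n : ℕ} {f g : (Fin n → ℝ) → ℂ} (hf : LocallyIntegrable f)
    (hg : LocallyIntegrable g) (z : Fin n → ℝ) {r : ℝ} (hr : 0 < r) :
    cubeOsc (f - g) z r ≤ cubeOsc f z r + cubeOsc g z r := by
  rw [sub_eq_add_neg, ← cubeOsc_neg g z hr]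
  exact cubeOsc_add_le hf hg.neg z hr

open Metric in
theorem meanOscillation_closedBall {n : ℕ} {f : (Fin n → ℝ) → ℂ} (hf : LocallyIntegrable f)
    (z : Fin n → ℝ) {r : ℝ} (hr : 0 < r) :
    meanOscillation f (closedBall z r) = ENNReal.ofReal (cubeOsc f z r) := by
  change ⨍⁻ x in closedBall z r, ‖f x - cubeAvg f z r‖ₑ ∂volume = _
  rw [setLAverage_eq, cubeOsc, cubeDev, setAverage_eq, smul_eq_mul,
    ENNReal.ofReal_mul (by positivity),
    ofReal_integral_eq_lintegral_ofReal (hf.integrableOn_norm_sub _ z r)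
      (Eventually.of_forall fun x => norm_nonneg _), ENNReal.div_eq_inv_mul]
  congr 1
  · rw [ENNReal.ofReal_inv_of_pos (by rw [volume_real_closedBall_pi z hr.le]; positivity),
      ofReal_measureReal (volume_closedBall_pi_ne_top z r)]
  · simp only [ofReal_norm]

theorem bmoSeminorm_le_ofReal {n : ℕ} {f : (Fin n → ℝ) → ℂ} (hf : LocallyIntegrable f) {K : ℝ}
    (h : ∀ z r, 0 < r → cubeOsc f z r ≤ K) : bmoSeminorm f ≤ ENNReal.ofReal K := by
  refine iSup₂_le fun Q hQ => ?_
  obtain ⟨z, r, hr, rfl⟩ := isCube_iff_exists_closedBall.1 hQ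
  rw [meanOscillation_closedBall hf z hr]
  exact ENNReal.ofReal_le_ofReal (h z r hr)

theorem ofReal_cubeOsc_le_bmoSeminorm {n : ℕ} {f : (Fin n → ℝ) → ℂ} (hf : LocallyIntegrable f)
    (z : Fin n → ℝ) {r : ℝ} (hr : 0 < r) : ENNReal.ofReal (cubeOsc f z r) ≤ bmoSeminorm f := by
  rw [← meanOscillation_closedBall hf z hr]
  exact le_iSup₂ (f := fun Q (_ : IsCube Q) => meanOscillation f Q) _
    (isCube_iff_exists_closedBall.2 ⟨z, r, hr, rfl⟩)

theorem MemBMO.exists_cubeOsc_le {n : ℕ} {f : (Fin n → ℝ) → ℂ} (hf : MemBMO f) :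
    ∃ K : ℝ, 0 < K ∧ ∀ z r, 0 < r → cubeOsc f z r ≤ K := by
  refine ⟨(bmoSeminorm f).toReal + 1, by positivity, fun z r hr => ?_⟩
  have := ENNReal.toReal_mono hf.2.ne (ofReal_cubeOsc_le_bmoSeminorm hf.1 z hr)
  rw [ENNReal.toReal_ofReal (cubeOsc_nonneg _ _ _)] at this
  linarith

/-! ### Growth of averages over nested cubes. -/

open Metric in
theorem norm_cubeAvg_sub_cubeAvg_le_of_subset {n : ℕ} {f : (Fin n → ℝ) → ℂ}
    (hf : LocallyIntegrable f) {z w : Fin n → ℝ} {r s : ℝ} (hr : 0 < r) (hs : 0 < s)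
    (h : closedBall z r ⊆ closedBall w s) :
    ‖cubeAvg f z r - cubeAvg f w s‖ ≤ (s / r) ^ n * cubeOsc f w s :=
  (norm_cubeAvg_sub_le hf _ z hr).trans (cubeDev_le_of_subset hf _ hr hs h)

open Metric in
-- Telescoping: each doubling costs 2ⁿK. Only concentric cubes of radius at least `r` enter, which
-- is all the cutoff argument can supply.
theorem norm_cubeAvg_sub_cubeAvg_two_pow_le {n : ℕ} {f : (Fin n → ℝ) → ℂ}
    (hf : LocallyIntegrable f) {z : Fin n → ℝ} {r K : ℝ} (hr : 0 < r)
    (hK : ∀ s, r ≤ s → cubeOsc f z s ≤ K) (j : ℕ) :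
    ‖cubeAvg f z r - cubeAvg f z (2 ^ j * r)‖ ≤ j * (2 ^ n * K) := by
  induction j with
  | zero => simp
  | succ j ih =>
    have h1 : ‖cubeAvg f z (2 ^ j * r) - cubeAvg f z (2 ^ (j + 1) * r)‖ ≤ 2 ^ n * K := by
      refine (norm_cubeAvg_sub_cubeAvg_le_of_subset hf (by positivity) (by positivity)
        (closedBall_subset_closedBall ?_)).trans ?_
      · gcongr <;> norm_num
      · rw [show 2 ^ (j + 1) * r / (2 ^ j * r) = 2 by field_simp; ring]
        gcongr
        exact hK _ (le_mul_of_one_le_left hr.le (one_le_pow₀ (by norm_num)))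
    have h2 := norm_sub_le_norm_sub_add_norm_sub (cubeAvg f z r) (cubeAvg f z (2 ^ j * r))
      (cubeAvg f z (2 ^ (j + 1) * r))
    push_cast
    linarith

/-- Trades logarithmic growth for a square root, which is easier to handle and still sublinear. -/
theorem add_three_le_four_mul_sqrt_two_pow (j : ℕ) : (j : ℝ) + 3 ≤ 4 * √(2 ^ j) := by
  have h : ((j : ℝ) + 3) ^ 2 ≤ 16 * 2 ^ j := by
    induction j with
    | zero => norm_num
    | succ j ih =>
      have : (0 : ℝ) ≤ j := j.cast_nonneg
      push_cast
      nlinarith [pow_succ (2 : ℝ) j]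
  have h2 := Real.le_sqrt_of_sq_le h
  rwa [Real.sqrt_mul (by norm_num), show (16 : ℝ) = 4 ^ 2 by norm_num,
    Real.sqrt_sq (by norm_num)] at h2

open Metric in
/-- The averages over nested cubes differ by at most a logarithm, hence a square root, of the ratio
of the sides times the oscillation. -/
theorem norm_cubeAvg_sub_cubeAvg_le_sqrt {n : ℕ} {f : (Fin n → ℝ) → ℂ}
    (hf : LocallyIntegrable f) {z w : Fin n → ℝ} {r s K : ℝ} (hr : 0 < r) (hrs : r ≤ s)
    (h : closedBall z r ⊆ closedBall w s) (hK : ∀ t, r ≤ t → cubeOsc f z t ≤ K) :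
    ‖cubeAvg f z r - cubeAvg f w s‖ ≤ 4 * 4 ^ n * K * √(s / r) := by
  have hs : 0 < s := hr.trans_le hrs
  have hK0 : 0 ≤ K := (cubeOsc_nonneg f z r).trans (hK r le_rfl)
  -- With 2^j ≤ s/r < 2^(j+1), the cube about `z` of radius 2^(j+2)·r > 2s contains `closedBall w
  -- s`; both averages are compared with the one over it.
  obtain ⟨j, hj, hj'⟩ := exists_nat_pow_near ((one_le_div hr).2 hrs) one_lt_two
  rw [le_div_iff₀ hr] at hj
  rw [div_lt_iff₀ hr] at hj'
  have h1 := norm_cubeAvg_sub_cubeAvg_two_pow_le hf hr hK (j + 2)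
  have hz : z ∈ closedBall w s := h (mem_closedBall_self hr.le)
  have h2 : ‖cubeAvg f w s - cubeAvg f z (2 ^ (j + 2) * r)‖ ≤ 4 ^ n * K := by
    refine (norm_cubeAvg_sub_cubeAvg_le_of_subset hf hs (by positivity)
      (closedBall_subset_closedBall' ?_)).trans ?_
    · rw [dist_comm]
      have := mem_closedBall.1 hz
      rw [pow_succ] at hj'
      rw [pow_add]
      linarith
    · gcongr
      · exact cubeOsc_nonneg _ _ _
      · rw [div_le_iff₀ hs, pow_add]; linarith
      · exact hK _ (le_mul_of_one_le_left hr.le (one_le_pow₀ (by norm_num)))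
  have h3 := norm_sub_le_norm_sub_add_norm_sub (cubeAvg f z r) (cubeAvg f z (2 ^ (j + 2) * r))
    (cubeAvg f w s)
  rw [norm_sub_rev] at h2
  have h4 : (2 : ℝ) ^ n ≤ 4 ^ n := by gcongr; norm_num
  have h5 : √(2 ^ j) ≤ √(s / r) := Real.sqrt_le_sqrt ((le_div_iff₀ hr).2 hj)
  have h6 := add_three_le_four_mul_sqrt_two_pow j
  push_cast at h1
  calc ‖cubeAvg f z r - cubeAvg f w s‖ ≤ (j + 2) * (2 ^ n * K) + 4 ^ n * K := by linarith
    _ ≤ (j + 2) * (4 ^ n * K) + 4 ^ n * K := by gcongr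
    _ = (j + 3) * (4 ^ n * K) := by ring
    _ ≤ (4 * √(s / r)) * (4 ^ n * K) := by gcongr; linarith
    _ = _ := by ring

open Metric in
-- Compare volumes. In dimension 0 all balls coincide and inclusion says nothing about radii.
theorem radius_le_of_closedBall_pi_subset {n : ℕ} (hn : 1 ≤ n) {z w : Fin n → ℝ} {r s : ℝ}
    (hr : 0 < r) (hs : 0 < s) (h : closedBall z r ⊆ closedBall w s) : r ≤ s := by
  have h1 := measureReal_mono (μ := volume) h (volume_closedBall_pi_ne_top w s)
  rw [volume_real_closedBall_pi z hr.le, volume_real_closedBall_pi w hs.le] at h1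
  have := (pow_le_pow_iff_left₀ (by positivity) (by positivity) (by omega)).1 h1
  linarith

/-! ### From closeness to constants to mean oscillation. -/

open Metric in
/-- Chebyshev's inequality on a cube. -/
theorem measure_lt_of_cubeDev_lt {n : ℕ} {f : (Fin n → ℝ) → ℂ} (hf : LocallyIntegrable f) {c : ℂ}
    {z : Fin n → ℝ} {r : ℝ} (hr : 0 < r) {lam α : ℝ} (hα : 0 < α)
    (h : cubeDev f c z r < lam * α) :
    volume {x ∈ closedBall z r | α < ‖f x - c‖} <
      ENNReal.ofReal lam * volume (closedBall z r) := by
  have h1 := mul_meas_ge_le_integral_of_nonneg (μ := volume.restrict (closedBall z r))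
    (Eventually.of_forall fun x => norm_nonneg (f x - c)) (hf.integrableOn_norm_sub c z r) α
  rw [setIntegral_eq_mul_cubeDev f c z hr] at h1
  have hV : 0 < (2 * r) ^ n := by positivity
  have h2 : (volume.restrict (closedBall z r)).real {x | α ≤ ‖f x - c‖} < lam * (2 * r) ^ n := by
    have : (2 * r) ^ n * cubeDev f c z r < (2 * r) ^ n * (lam * α) := by gcongr
    nlinarith
  have hlam : 0 < lam := by
    by_contra! hcon
    have := cubeDev_nonneg f c z r
    nlinarith
  have h3 : {x ∈ closedBall z r | α < ‖f x - c‖} ⊆ closedBall z r := fun x hx => hx.1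
  have h4 : volume {x ∈ closedBall z r | α < ‖f x - c‖} ≤
      volume.restrict (closedBall z r) {x | α ≤ ‖f x - c‖} := by
    rw [← Measure.restrict_eq_self volume h3]
    exact measure_mono fun x hx => hx.2.le
  refine h4.trans_lt ?_
  rw [← volume_real_closedBall_pi z hr.le] at h2
  have hfin' : volume.restrict (closedBall z r) {x | α ≤ ‖f x - c‖} ≠ ⊤ :=
    ((measure_mono (Set.subset_univ _)).trans_lt ((Measure.restrict_apply_univ _).trans_lt
      (volume_closedBall_pi_ne_top z r).lt_top)).ne
  rw [← ofReal_measureReal hfin',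
    ← ofReal_measureReal (volume_closedBall_pi_ne_top z r), ← ENNReal.ofReal_mul hlam.le]
  refine (ENNReal.ofReal_lt_ofReal_iff ?_).2 h2
  rw [volume_real_closedBall_pi z hr.le]
  positivity

theorem nearConst_of_cubeDev_lt {n : ℕ} {f : (Fin n → ℝ) → ℂ} (hf : LocallyIntegrable f) {c : ℂ}
    {z : Fin n → ℝ} {r : ℝ} (hr : 0 < r) {α : ℝ} (hα : 0 < α) (h : cubeDev f c z r < α / 2) :
    NearConst f α (Metric.closedBall z r) c := by
  have := measure_lt_of_cubeDev_lt hf hr hα (lam := 1 / 2)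
    (show cubeDev f c z r < 1 / 2 * α by linarith)
  rwa [ENNReal.ofReal_div_of_pos (by norm_num), ENNReal.ofReal_one, ENNReal.ofReal_ofNat,
    one_div, ← ENNReal.div_eq_inv_mul] at this

/-- Two exceptional sets, each below half of `Q`, cannot cover `Q`; a common good point compares the
constants. -/
theorem NearConst.norm_sub_le {n : ℕ} {f : (Fin n → ℝ) → ℂ} {Q : Set (Fin n → ℝ)} {α β : ℝ}
    {c d : ℂ} (hc : NearConst f α Q c) (hd : NearConst f β Q d) : ‖c - d‖ ≤ α + β := by
  obtain ⟨x, hxc, hxd⟩ : ∃ x, ‖f x - c‖ ≤ α ∧ ‖f x - d‖ ≤ β := by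
    by_contra! hcon
    have hsub : Q ⊆ {x ∈ Q | α < ‖f x - c‖} ∪ {x ∈ Q | β < ‖f x - d‖} := by
      intro x hx
      by_cases h : ‖f x - c‖ ≤ α
      · exact Or.inr ⟨hx, hcon x h⟩
      · exact Or.inl ⟨hx, not_le.1 h⟩
    have := ((measure_mono hsub).trans (measure_union_le _ _)).trans_lt
      (ENNReal.add_lt_add hc hd)
    rw [ENNReal.add_halves] at this
    exact lt_irrefl _ this
  have : c - d = (f x - d) - (f x - c) := by ring
  rw [this]
  exact (_root_.norm_sub_le (f x - d) (f x - c)).trans (by linarith)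

/-- Here `lam ≤ 1/2` enters: the exceptional set has measure below λ|Q| ≤ |Q|/2. -/
theorem exists_nearConst_of_localMeanOscillation_lt {n : ℕ} {f : (Fin n → ℝ) → ℂ}
    {Q : Set (Fin n → ℝ)} {lam ε : ℝ} (hlam : lam ≤ 1 / 2)
    (h : localMeanOscillation lam f Q < ENNReal.ofReal ε) : ∃ c, NearConst f ε Q c := by
  obtain ⟨c, hc⟩ := iInf_lt_iff.1 h
  obtain ⟨α, ⟨-, hα⟩, hαε⟩ := sInf_lt_iff.1 hc
  refine ⟨c, lt_of_le_of_lt (measure_mono ?_) (hα.trans_le ?_)⟩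
  · rintro x ⟨hx, hxε⟩
    change α < ‖Q.indicator (fun x => f x - c) x‖ₑ
    rw [Set.indicator_of_mem hx, ← ofReal_norm]
    exact hαε.trans_le (ENNReal.ofReal_le_ofReal hxε.le)
  · rw [ENNReal.div_eq_inv_mul]
    gcongr
    calc ENNReal.ofReal lam ≤ ENNReal.ofReal (1 / 2) := ENNReal.ofReal_le_ofReal hlam
      _ = 2⁻¹ := by
        rw [one_div, ENNReal.ofReal_inv_of_pos (by norm_num), ENNReal.ofReal_ofNat]

open Metric in
theorem setIntegral_norm_sub_le_add {n : ℕ} {f : (Fin n → ℝ) → ℂ} (hf : LocallyIntegrable f)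
    {P : Set (Fin n → ℝ)} (hP : MeasurableSet P)
    {z : Fin n → ℝ} {r : ℝ} (hr : 0 < r) {ε : ℝ} (hε : 0 < ε)
    (hgood : ∀ w ρ, 0 < ρ → closedBall w ρ ⊆ closedBall z r → ¬ closedBall w ρ ⊆ P →
      ∃ c, NearConst f ε (closedBall w ρ) c)
    {m : ℂ} (hm : NearConst f ε (closedBall z r) m) :
    ∫ x in closedBall z r, ‖f x - m‖ ≤
      (8 * 5 ^ n + 1) * ε * (2 * r) ^ n + ∫ x in closedBall z r ∩ P, ‖f x - m‖ := by
  have hi := hf.integrableOn_norm_sub m z r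
  rw [← integral_inter_add_sdiff hP hi, add_comm]
  gcongr
  rw [integral_eq_lintegral_of_nonneg_ae (Eventually.of_forall fun x => norm_nonneg _)
    (hi.mono_set Set.sdiff_subset).aestronglyMeasurable]
  refine ENNReal.toReal_le_of_le_ofReal (by positivity) ?_
  have := lintegral_enorm_sub_le hf.aestronglyMeasurable hr hε hgood hm
  simp only [ofReal_norm]
  rwa [ENNReal.ofReal_mul (by positivity), ← volume_real_closedBall_pi z hr.le,
    ofReal_measureReal (volume_closedBall_pi_ne_top z r)]

open Metric in
theorem cubeOsc_le_of_nearConst_subcubes {n : ℕ} {f : (Fin n → ℝ) → ℂ} (hf : LocallyIntegrable f)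
    {z : Fin n → ℝ} {r : ℝ} (hr : 0 < r) {ε : ℝ} (hε : 0 < ε)
    (hgood : ∀ w ρ, 0 < ρ → closedBall w ρ ⊆ closedBall z r →
      ∃ c, NearConst f ε (closedBall w ρ) c) :
    cubeOsc f z r ≤ 2 * ((8 * 5 ^ n + 1) * ε) := by
  obtain ⟨m, hm⟩ := hgood z r hr le_rfl
  have h := setIntegral_norm_sub_le_add hf MeasurableSet.empty hr hε
    (fun w ρ h1 h2 _ => hgood w ρ h1 h2) hm
  rw [Set.inter_empty, Measure.restrict_empty, integral_zero_measure, add_zero,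
    setIntegral_eq_mul_cubeDev f m z hr, mul_comm] at h
  have := le_of_mul_le_mul_right h (by positivity)
  linarith [cubeOsc_le_two_mul_cubeDev hf m z hr]

theorem add_mul_sqrt_le_mul_of_sq_le {a b ε y : ℝ} (ha : 0 ≤ a) (hb : 0 ≤ b) (hε : 0 < ε)
    (hy : 1 ≤ y) (h : ((a + 2 * b) / ε) ^ 2 ≤ y) : a + b * √(3 * y) ≤ ε * y := by
  have hs : √y * √y = y := Real.mul_self_sqrt (by linarith)
  have h1 : 1 ≤ √y := Real.one_le_sqrt.2 hy
  have h2 : √(3 * y) ≤ 2 * √y := by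
    rw [show (2 : ℝ) * √y = √(2 ^ 2 * y) by rw [Real.sqrt_mul (by norm_num), Real.sqrt_sq (by norm_num)]]
    apply Real.sqrt_le_sqrt; linarith
  have h3 := Real.le_sqrt_of_sq_le h
  rw [div_le_iff₀ hε] at h3
  calc a + b * √(3 * y) ≤ a * √y + b * (2 * √y) := by
        gcongr
        nlinarith
    _ = (a + 2 * b) * √y := by ring
    _ ≤ (√y * ε) * √y := by gcongr
    _ = ε * y := by rw [mul_assoc, mul_comm ε, ← mul_assoc, hs, mul_comm]

open Metric in
/-- If `f ∈ BMO` is `ε`-close to a constant on more than half of each cube not contained in a fixed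
one, then its mean oscillation is `O(ε)` on all sufficiently large cubes. -/
theorem exists_cubeOsc_le_of_large {n : ℕ} (hn : 1 ≤ n) {f : (Fin n → ℝ) → ℂ}
    (hf : LocallyIntegrable f) {K : ℝ} (hK0 : 0 < K) (hK : ∀ z r, 0 < r → cubeOsc f z r ≤ K)
    {ρ : ℝ} (hρ : 0 < ρ) {ε : ℝ} (hε : 0 < ε)
    (hgood : ∀ w s, 0 < s → ¬ closedBall w s ⊆ closedBall (0 : Fin n → ℝ) ρ →
      ∃ c, NearConst f ε (closedBall w s) c) :
    ∃ R, 0 < R ∧ ∀ z r, R < r → cubeOsc f z r ≤ 2 * ((8 * 5 ^ n + 2) * ε) := by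
  -- `a + b √(3r/ρ)` bounds the mean deviation of `f` from `m` over the exceptional cube; beyond `Y`
  -- this is at most ε·r/ρ.
  set a := K + (3 ^ n * K + (4 * K + ε)) with ha
  set b := 4 * 4 ^ n * K with hb
  set Y := max 1 (((a + 2 * b) / ε) ^ 2) with hY
  have hY1 : 1 ≤ Y := le_max_left _ _
  refine ⟨ρ * Y, by positivity, fun z r hr => ?_⟩
  have hrρ : ρ < r := lt_of_le_of_lt (le_mul_of_one_le_right hρ.le hY1) hr
  have hr0 : 0 < r := hρ.trans hrρ
  obtain ⟨m, hm⟩ := hgood z r hr0 fun h =>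
    absurd (radius_le_of_closedBall_pi_subset hn hr0 hρ h) (not_le.2 hrρ)
  have h := setIntegral_norm_sub_le_add hf (measurableSet_closedBall (x := (0 : Fin n → ℝ)) (ε := ρ))
    hr0 hε (fun w s h1 _ h3 => hgood w s h1 h3) hm
  have hP : ∫ x in closedBall z r ∩ closedBall 0 ρ, ‖f x - m‖ ≤ ε * (2 * r) ^ n := by
    rcases (closedBall z r ∩ closedBall 0 ρ).eq_empty_or_nonempty with he | ⟨x, hxz, hx0⟩
    · rw [he, Measure.restrict_empty, integral_zero_measure]
      positivity
    · have h1 : ∫ x in closedBall z r ∩ closedBall 0 ρ, ‖f x - m‖ ≤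
          ∫ x in closedBall 0 ρ, ‖f x - m‖ :=
        setIntegral_mono_set (hf.integrableOn_norm_sub m 0 ρ)
          (Eventually.of_forall fun x => norm_nonneg _) Set.inter_subset_right.eventuallyLE
      refine h1.trans ?_
      rw [setIntegral_eq_mul_cubeDev f m 0 hρ]
      have h2 := cubeDev_le_cubeDev_add_norm hf m (cubeAvg f 0 ρ) 0 hρ
      have h3 : cubeDev f (cubeAvg f 0 ρ) 0 ρ ≤ K := hK 0 ρ hρ
      -- Chebyshev at level 4K: a mean deviation of at most K is strictly below half of 4K.
      have h4 : ‖cubeAvg f z r - m‖ ≤ 4 * K + ε := by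
        refine NearConst.norm_sub_le (nearConst_of_cubeDev_lt hf hr0 (by positivity) ?_) hm
        have : cubeDev f (cubeAvg f z r) z r ≤ K := hK z r hr0
        linarith
      have hsub : closedBall z r ⊆ closedBall 0 (3 * r) := by
        apply closedBall_subset_closedBall'
        have := dist_triangle_left z 0 x
        rw [mem_closedBall] at hxz hx0
        linarith
      have h5 : ‖cubeAvg f z r - cubeAvg f 0 (3 * r)‖ ≤ 3 ^ n * K := by
        refine (norm_cubeAvg_sub_cubeAvg_le_of_subset hf hr0 (by positivity) hsub).trans ?_
        rw [mul_div_assoc, div_self hr0.ne', mul_one]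
        gcongr
        exact hK _ _ (by positivity)
      have h6 : ‖cubeAvg f 0 ρ - cubeAvg f 0 (3 * r)‖ ≤ b * √(3 * (r / ρ)) := by
        rw [← mul_div_assoc]
        exact norm_cubeAvg_sub_cubeAvg_le_sqrt hf hρ (by linarith)
          (closedBall_subset_closedBall (by linarith)) fun t ht => hK 0 t (hρ.trans_le ht)
      have h7 : ‖cubeAvg f 0 ρ - m‖ ≤ b * √(3 * (r / ρ)) + (3 ^ n * K + (4 * K + ε)) := by
        have e1 := norm_sub_le_norm_sub_add_norm_sub (cubeAvg f 0 ρ) (cubeAvg f 0 (3 * r)) m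
        have e2 := norm_sub_le_norm_sub_add_norm_sub (cubeAvg f 0 (3 * r)) (cubeAvg f z r) m
        rw [norm_sub_rev] at h5
        linarith
      have hy : Y ≤ r / ρ := by rw [le_div_iff₀ hρ]; linarith
      have h8 := add_mul_sqrt_le_mul_of_sq_le (a := a) (b := b) (by positivity) (by positivity) hε
        (hY1.trans hy) ((le_max_right _ _).trans hy)
      have h9 : cubeDev f m 0 ρ ≤ ε * (r / ρ) ^ n := by
        have : ε * (r / ρ) ≤ ε * (r / ρ) ^ n := by
          gcongr
          exact le_self_pow₀ (hY1.trans hy) (by omega)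
        linarith
      calc (2 * ρ) ^ n * cubeDev f m 0 ρ ≤ (2 * ρ) ^ n * (ε * (r / ρ) ^ n) := by gcongr
        _ = ε * (2 * ρ * (r / ρ)) ^ n := by rw [mul_pow (2 * ρ)]; ring
        _ = ε * (2 * r) ^ n := by congr 2; field_simp
  rw [setIntegral_eq_mul_cubeDev f m z hr0] at h
  have h' : (2 * r) ^ n * cubeDev f m z r ≤ (2 * r) ^ n * ((8 * 5 ^ n + 2) * ε) := by linarith
  have := le_of_mul_le_mul_left h' (by positivity)
  linarith [cubeOsc_le_two_mul_cubeDev hf m z hr0]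

/-! ### Extreme cubes: local mean oscillation controls mean oscillation. -/

open Metric in
/-- The cube `closedBall z r` is smaller than `δ`, larger than `R`, or far from the origin. -/
def IsExtremeCube {n : ℕ} (δ R d : ℝ) (z : Fin n → ℝ) (r : ℝ) : Prop :=
  r < δ ∨ R < r ∨ Disjoint (closedBall z r) (closedBall 0 d)

open Metric in
/-- The functional `Φ` on cubes vanishes in the limit of small, of large, and of distant cubes. -/
def VanishesOnExtremeCubes {n : ℕ} (Φ : (Fin n → ℝ) → ℝ → ℝ≥0∞) : Prop :=
  ∀ ε : ℝ, 0 < ε → ∃ δ R d : ℝ, 0 < δ ∧ 0 < R ∧ 0 < d ∧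
    ∀ z r, 0 < r → IsExtremeCube δ R d z r → Φ z r ≤ ENNReal.ofReal ε

open Metric in
theorem vanishesOnExtremeCubes_cubeOsc {n : ℕ} (hn : 1 ≤ n) {lam : ℝ} (hlam : lam ≤ 1 / 2)
    {f : (Fin n → ℝ) → ℂ} (hf : MemBMO f)
    (h : VanishesOnExtremeCubes fun z r => localMeanOscillation lam f (closedBall z r)) :
    VanishesOnExtremeCubes fun z r => ENNReal.ofReal (cubeOsc f z r) := by
  intro ε hε
  obtain ⟨K, hK0, hK⟩ := hf.exists_cubeOsc_le
  set ε' := ε / (2 * (8 * 5 ^ n + 2)) with hε'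
  have hε'0 : 0 < ε' := by positivity
  have hεeq : 2 * ((8 * 5 ^ n + 2) * ε') = ε := by rw [hε']; field_simp
  have hεle : 2 * ((8 * 5 ^ n + 1) * ε') ≤ ε := by linarith
  obtain ⟨δ, R, d, hδ, hR, hd, hext⟩ := h (ε' / 2) (by positivity)
  have hgood : ∀ z r, 0 < r → IsExtremeCube δ R d z r → ∃ c, NearConst f ε' (closedBall z r) c :=
    fun z r hr hzr => exists_nearConst_of_localMeanOscillation_lt hlam
      ((hext z r hr hzr).trans_lt ((ENNReal.ofReal_lt_ofReal_iff hε'0).2 (by linarith)))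
  obtain ⟨R', hR', hlarge⟩ := exists_cubeOsc_le_of_large hn hf.1 hK0 hK
    -- A cube of radius at most R meeting `closedBall 0 d` lies in `closedBall 0 (d + 2R)`, so every
    -- cube not inside the latter is extreme.
    (ρ := d + 2 * R) (by positivity) hε'0 (by
      intro w s hs hws
      refine hgood w s hs ?_
      by_contra hcon
      simp only [IsExtremeCube, not_or, not_lt] at hcon
      obtain ⟨x, hxw, hx0⟩ := Set.not_disjoint_iff.1 hcon.2.2
      refine hws (closedBall_subset_closedBall' ?_)
      have := dist_triangle_left w 0 x
      rw [mem_closedBall] at hxw hx0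
      linarith)
  refine ⟨δ, R', d, hδ, hR', hd, fun z r hr hzr => ENNReal.ofReal_le_ofReal ?_⟩
  rcases hzr with h1 | h1 | h1
  · refine (cubeOsc_le_of_nearConst_subcubes hf.1 hr hε'0 fun w ρ hρ hsub => ?_).trans hεle
    exact hgood w ρ hρ (Or.inl ((radius_le_of_closedBall_pi_subset hn hρ hr hsub).trans_lt h1))
  · exact (hlarge z r h1).trans hεeq.le
  · refine (cubeOsc_le_of_nearConst_subcubes hf.1 hr hε'0 fun w ρ hρ hsub => ?_).trans hεle
    exact hgood w ρ hρ (Or.inr (Or.inr (h1.mono_left hsub)))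

/-! ### Cutting off. -/

/-- The piecewise linear cutoff equal to `1` on `closedBall 0 D` and to `0` off `closedBall 0 (2D)`. -/
noncomputable def cubeCutoff {n : ℕ} (D : ℝ) (x : Fin n → ℝ) : ℝ := max 0 (min 1 (2 - ‖x‖ / D))

theorem cubeCutoff_nonneg {n : ℕ} (D : ℝ) (x : Fin n → ℝ) : 0 ≤ cubeCutoff D x := le_max_left _ _

theorem cubeCutoff_le_one {n : ℕ} (D : ℝ) (x : Fin n → ℝ) : cubeCutoff D x ≤ 1 :=
  max_le zero_le_one (min_le_left _ _)

theorem cubeCutoff_eq_one {n : ℕ} {D : ℝ} (hD : 0 < D) {x : Fin n → ℝ} (hx : ‖x‖ ≤ D) :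
    cubeCutoff D x = 1 := by
  have : ‖x‖ / D ≤ 1 := (div_le_one hD).2 hx
  rw [cubeCutoff, min_eq_left (by linarith), max_eq_right zero_le_one]

theorem cubeCutoff_eq_zero {n : ℕ} {D : ℝ} (hD : 0 < D) {x : Fin n → ℝ} (hx : 2 * D ≤ ‖x‖) :
    cubeCutoff D x = 0 := by
  have : 2 ≤ ‖x‖ / D := (le_div_iff₀ hD).2 hx
  rw [cubeCutoff, max_eq_left]
  exact (min_le_right _ _).trans (by linarith)

theorem abs_cubeCutoff_sub_le {n : ℕ} {D : ℝ} (hD : 0 < D) (x y : Fin n → ℝ) :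
    |cubeCutoff D x - cubeCutoff D y| ≤ dist x y / D := by
  have h1 : |cubeCutoff D x - cubeCutoff D y| ≤ |(2 - ‖x‖ / D) - (2 - ‖y‖ / D)| := by
    unfold cubeCutoff
    have h2 := abs_max_sub_max_le_max (0 : ℝ) (min 1 (2 - ‖x‖ / D)) 0 (min 1 (2 - ‖y‖ / D))
    have h3 := abs_min_sub_min_le_max (1 : ℝ) (2 - ‖x‖ / D) 1 (2 - ‖y‖ / D)
    rw [sub_self, abs_zero] at h2 h3
    exact h2.trans (max_le (abs_nonneg _) (h3.trans (max_le (abs_nonneg _) le_rfl)))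
  refine h1.trans ?_
  rw [show (2 - ‖x‖ / D) - (2 - ‖y‖ / D) = (‖y‖ - ‖x‖) / D by ring, abs_div, abs_of_pos hD,
    dist_comm, dist_eq_norm]
  gcongr
  exact abs_norm_sub_norm_le y x

theorem continuous_cubeCutoff {n : ℕ} (D : ℝ) :
    Continuous (cubeCutoff D : (Fin n → ℝ) → ℝ) := by
  unfold cubeCutoff
  fun_prop

/-- The variation r/D of the cutoff over a cube of radius r absorbs the square-root growth of the
averages between scales r and 3D. -/
theorem div_mul_sqrt_three_mul_div_le_one {r D : ℝ} (hr : 0 < r) (hD : 0 < D) (h : r ≤ D / 4) :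
    r / D * √(3 * D / r) ≤ 1 := by
  have h1 : r / D * √(3 * D / r) = √((r / D) ^ 2 * (3 * D / r)) := by
    rw [Real.sqrt_mul (by positivity), Real.sqrt_sq (by positivity)]
  rw [h1, show (r / D) ^ 2 * (3 * D / r) = 3 * r / D by field_simp, Real.sqrt_le_iff]
  exact ⟨zero_le_one, by rw [one_pow, div_le_one hD]; linarith⟩

open Metric in
/-- A function whose oscillation is small on large and on distant cubes is close in BMO to one of
compact support. -/
theorem exists_hasCompactSupport_cubeOsc_sub_le {n : ℕ} {f : (Fin n → ℝ) → ℂ}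
    (hf : LocallyIntegrable f) {ε R d : ℝ} (hR : 0 < R) (hd : 0 < d)
    (hosc : ∀ z r, 0 < r → R < r ∨ Disjoint (closedBall z r) (closedBall 0 d) →
      cubeOsc f z r ≤ ε) :
    ∃ h : (Fin n → ℝ) → ℂ, LocallyIntegrable h ∧ HasCompactSupport h ∧
      ∀ z r, 0 < r → cubeOsc (f - h) z r ≤ 2 * (1 + 4 * 4 ^ n + 12 ^ n) * ε := by
  -- D/4 > R makes cubes of radius above D/4 large. D also exceeds D/4 + R + d, so a cube of radius
  -- at most D/4 leaving `closedBall 0 D`, even enlarged concentrically to radius R, misses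
  -- `closedBall 0 d`.
  set D := 2 * d + 8 * R with hDdef
  have hD : 0 < D := by positivity
  have hε : 0 ≤ ε := (cubeOsc_nonneg f 0 (2 * R)).trans
    (hosc 0 (2 * R) (by positivity) (Or.inl (by linarith)))
  set c := cubeAvg f 0 (3 * D) with hc
  set h : (Fin n → ℝ) → ℂ := fun x => cubeCutoff D x • (f x - c) with hh
  have hli : LocallyIntegrable h :=
    (hf.sub (locallyIntegrable_const c)).continuous_smul (continuous_cubeCutoff D)
  have hfh : LocallyIntegrable (f - h) := hf.sub hli
  have hzero : ∀ x, 2 * D ≤ ‖x‖ → h x = 0 := fun x hx => by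
    simp only [hh, cubeCutoff_eq_zero hD hx, zero_smul]
  refine ⟨h, hli, ?_, fun z r hr => ?_⟩
  · refine HasCompactSupport.of_support_subset_isCompact (isCompact_closedBall 0 (2 * D)) ?_
    intro x hx
    rw [mem_closedBall, dist_zero_right]
    by_contra! hcon
    exact hx (hzero x hcon.le)
  have h4 : (0 : ℝ) ≤ 4 ^ n * ε := by positivity
  have h12 : (0 : ℝ) ≤ 12 ^ n * ε := by positivity
  rcases le_or_gt r (D / 4) with hrD | hrD
  · by_cases hin : closedBall z r ⊆ closedBall 0 D
    · have h1 : cubeDev (f - h) c z r ≤ 0 := cubeDev_le_of_forall_le hfh hr fun x hx => by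
        have := hin hx
        rw [mem_closedBall, dist_zero_right] at this
        simp [hh, cubeCutoff_eq_one hD this]
      refine (cubeOsc_le_two_mul_cubeDev hfh c z hr).trans ?_
      nlinarith
    · obtain ⟨x₁, hx₁, hx₁D⟩ := Set.not_subset.1 hin
      rw [mem_closedBall, dist_zero_right, not_le] at hx₁D
      have hosc' : ∀ t, r ≤ t → cubeOsc f z t ≤ ε := by
        intro t ht
        refine hosc z t (hr.trans_le ht) ?_
        rcases lt_or_ge R t with h1 | h1
        · exact Or.inl h1
        · right
          rw [Set.disjoint_left]
          intro y hy hyd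
          rw [mem_closedBall] at hy
          rw [mem_closedBall, dist_zero_right] at hyd
          have h2 := dist_triangle_right x₁ y z
          have h3 : ‖x₁‖ ≤ dist x₁ y + ‖y‖ := by
            rw [← dist_zero_right, ← dist_zero_right]; exact dist_triangle _ _ _
          rw [mem_closedBall] at hx₁
          linarith
      set q := cubeAvg f z r with hq
      have hvar : ∀ x ∈ closedBall z r,
          |cubeCutoff D z - cubeCutoff D x| * ‖q - c‖ ≤ 4 * 4 ^ n * ε := by
        intro x hx
        by_cases hmeet : Disjoint (closedBall z r) (closedBall 0 (2 * D))
        · have : ∀ y ∈ closedBall z r, cubeCutoff D y = 0 := fun y hy => by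
            refine cubeCutoff_eq_zero hD ?_
            by_contra! hcon
            exact Set.disjoint_left.1 hmeet hy (by
              rw [mem_closedBall, dist_zero_right]; exact hcon.le)
          rw [this x hx, this z (mem_closedBall_self hr.le), sub_self, abs_zero, zero_mul]
          positivity
        · obtain ⟨y, hyz, hy0⟩ := Set.not_disjoint_iff.1 hmeet
          have hsub : closedBall z r ⊆ closedBall 0 (3 * D) := by
            apply closedBall_subset_closedBall'
            have := dist_triangle_left z 0 y
            rw [mem_closedBall] at hyz hy0
            linarith
          have h1 := norm_cubeAvg_sub_cubeAvg_le_sqrt hf hr (by linarith) hsub hosc'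
          have h2 : |cubeCutoff D z - cubeCutoff D x| ≤ r / D := by
            refine (abs_cubeCutoff_sub_le hD z x).trans ?_
            gcongr
            rw [dist_comm]; exact hx
          calc |cubeCutoff D z - cubeCutoff D x| * ‖q - c‖
              ≤ r / D * (4 * 4 ^ n * ε * √(3 * D / r)) := by gcongr
            _ = 4 * 4 ^ n * ε * (r / D * √(3 * D / r)) := by ring
            _ ≤ 4 * 4 ^ n * ε * 1 := by
              gcongr
              exact div_mul_sqrt_three_mul_div_le_one hr hD hrD
            _ = _ := mul_one _
      -- Here f - h = c + (1 - ψ)(f - c) with ψ the cutoff. The test constant freezes ψ at the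
      -- centre and `f` at its average `q`.
      have h1 : cubeDev (f - h) (c + (1 - cubeCutoff D z) • (q - c)) z r ≤
          1 * cubeDev f q z r + 4 * 4 ^ n * ε := by
        refine cubeDev_le_mul_cubeDev_add hfh hf hr fun x hx => ?_
        have e : (f - h) x - (c + (1 - cubeCutoff D z) • (q - c)) =
            (1 - cubeCutoff D x) • (f x - q) +
              (cubeCutoff D z - cubeCutoff D x) • (q - c) := by
          simp only [hh, Pi.sub_apply, Complex.real_smul]
          push_cast
          ring
        rw [e]
        refine (norm_add_le _ _).trans ?_
        rw [norm_smul, norm_smul, Real.norm_eq_abs, Real.norm_eq_abs]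
        have := cubeCutoff_nonneg D x
        have := cubeCutoff_le_one D x
        refine add_le_add (mul_le_mul_of_nonneg_right ?_ (norm_nonneg _)) (hvar x hx)
        rw [abs_le]; constructor <;> linarith
      have h2 : cubeDev f q z r ≤ ε := hosc' r le_rfl
      have h3 := cubeOsc_le_two_mul_cubeDev hfh (c + (1 - cubeCutoff D z) • (q - c)) z hr
      linarith
  · have hRr : R < r := by linarith
    have h1 : cubeDev h 0 z r ≤ 12 ^ n * ε := by
      rw [cubeDev_eq _ _ _ hr.le]
      have e1 : ∫ x in closedBall z r, ‖h x - 0‖ =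
          ∫ x in closedBall z r ∩ closedBall 0 (3 * D), ‖h x - 0‖ := by
        refine setIntegral_eq_of_subset_of_forall_sdiff_eq_zero measurableSet_closedBall
          Set.inter_subset_left ?_
        rintro x ⟨hx, hx'⟩
        rw [sub_zero, hzero x ?_, norm_zero]
        by_contra! hcon
        exact hx' ⟨hx, by rw [mem_closedBall, dist_zero_right]; linarith⟩
      have e2 : ∫ x in closedBall z r ∩ closedBall 0 (3 * D), ‖h x - 0‖ ≤
          ∫ x in closedBall 0 (3 * D), ‖h x - 0‖ :=
        setIntegral_mono_set (hli.integrableOn_norm_sub 0 _ _)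
          (Eventually.of_forall fun x => norm_nonneg _) Set.inter_subset_right.eventuallyLE
      have e3 : ∫ x in closedBall 0 (3 * D), ‖h x - 0‖ ≤ ∫ x in closedBall 0 (3 * D), ‖f x - c‖ := by
        refine setIntegral_mono_on (hli.integrableOn_norm_sub 0 _ _)
          (hf.integrableOn_norm_sub c _ _) measurableSet_closedBall fun x _ => ?_
        rw [sub_zero, hh, norm_smul, Real.norm_of_nonneg (cubeCutoff_nonneg D x)]
        exact mul_le_of_le_one_left (norm_nonneg _) (cubeCutoff_le_one D x)
      rw [setIntegral_eq_mul_cubeDev f c 0 (by positivity)] at e3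
      have e4 : cubeDev f c 0 (3 * D) ≤ ε := hosc 0 (3 * D) (by positivity) (Or.inl (by linarith))
      rw [inv_mul_le_iff₀ (by positivity), e1]
      calc _ ≤ (2 * (3 * D)) ^ n * ε := e2.trans (e3.trans (by gcongr))
        _ ≤ (2 * r * 12) ^ n * ε :=
          mul_le_mul_of_nonneg_right (pow_le_pow_left₀ (by positivity) (by linarith) n) hε
        _ = (2 * r) ^ n * (12 ^ n * ε) := by rw [mul_pow]; ring
    have h2 : cubeDev (f - h) (cubeAvg f z r) z r ≤ cubeOsc f z r + cubeDev h 0 z r := by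
      have h3 := cubeDev_sub_le hf hli (cubeAvg f z r) 0 z hr
      rwa [sub_zero] at h3
    have h3 := hosc z r hr (Or.inl hRr)
    have h5 := cubeOsc_le_two_mul_cubeDev hfh (cubeAvg f z r) z hr
    linarith

/-! ### Mollification. -/

open Metric in
/-- Integrals over a large cube are controlled by the averages over all cubes of a fixed smaller
size. -/
theorem setLIntegral_closedBall_le_of_forall_small {n : ℕ} {w : (Fin n → ℝ) → ℝ≥0∞}
    (hw : AEMeasurable w) {ρ : ℝ} (hρ : 0 < ρ) {A : ℝ≥0∞}
    (h : ∀ y, ∫⁻ x in closedBall y ρ, w x ≤ A * volume (closedBall y ρ))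
    (z : Fin n → ℝ) {r : ℝ} (hr : ρ ≤ r) :
    ∫⁻ x in closedBall z r, w x ≤ 2 ^ n * A * volume (closedBall z r) := by
  have hr0 : 0 < r := hρ.trans_le hr
  set V : ℝ≥0∞ := ENNReal.ofReal ((2 * ρ) ^ n) with hV
  have hvol : ∀ y : Fin n → ℝ, volume (closedBall y ρ) = V := fun y => by
    rw [Real.volume_pi_closedBall y hρ.le, Fintype.card_fin]
  have hV0 : V ≠ 0 := (ENNReal.ofReal_pos.2 (by positivity)).ne'
  have hVt : V ≠ ⊤ := ENNReal.ofReal_ne_top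
  set T : Set ((Fin n → ℝ) × (Fin n → ℝ)) := {p | dist p.1 p.2 ≤ ρ} with hT
  have hTm : MeasurableSet T := measurableSet_le (by fun_prop) measurable_const
  -- Integrate `w x` over pairs with dist x y ≤ ρ in both orders. Only y in `closedBall z (r + ρ)`
  -- contribute, and r + ρ ≤ 2r gives 2ⁿ.
  have key : (∫⁻ x in closedBall z r, w x) * V ≤ (2 ^ n * A * volume (closedBall z r)) * V := by
    calc (∫⁻ x in closedBall z r, w x) * V
        = ∫⁻ x in closedBall z r, w x * V := (lintegral_mul_const' _ _ hVt).symm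
      _ = ∫⁻ x in closedBall z r, ∫⁻ y, T.indicator (fun p => w p.1) (x, y) := by
          refine lintegral_congr fun x => ?_
          have : ∀ y, T.indicator (fun p => w p.1) (x, y) =
              (closedBall x ρ).indicator (fun _ => w x) y := fun y => by
            by_cases hxy : dist x y ≤ ρ
            · rw [Set.indicator_of_mem (show (x, y) ∈ T from hxy),
                Set.indicator_of_mem (by rwa [mem_closedBall, dist_comm])]
            · rw [Set.indicator_of_notMem (show (x, y) ∉ T from hxy),
                Set.indicator_of_notMem (by rwa [mem_closedBall, dist_comm])]
          simp_rw [this]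
          rw [lintegral_indicator measurableSet_closedBall, setLIntegral_const, hvol]
      _ = ∫⁻ y, ∫⁻ x in closedBall z r, T.indicator (fun p => w p.1) (x, y) := by
          rw [lintegral_lintegral_swap]
          exact (hw.restrict.comp_fst).indicator hTm
      _ ≤ ∫⁻ y, (closedBall z (r + ρ)).indicator (fun _ => A * V) y := by
          refine lintegral_mono fun y => ?_
          by_cases hy : y ∈ closedBall z (r + ρ)
          · rw [Set.indicator_of_mem hy, ← hvol y]
            refine le_trans ?_ (h y)
            refine (setLIntegral_le_lintegral _ _).trans (le_of_eq ?_)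
            rw [← lintegral_indicator measurableSet_closedBall]
            refine lintegral_congr fun x => ?_
            by_cases hxy : dist x y ≤ ρ
            · rw [Set.indicator_of_mem (show (x, y) ∈ T from hxy),
                Set.indicator_of_mem (show x ∈ closedBall y ρ from hxy)]
            · rw [Set.indicator_of_notMem (show (x, y) ∉ T from hxy),
                Set.indicator_of_notMem (show x ∉ closedBall y ρ from hxy)]
          · rw [Set.indicator_of_notMem hy, nonpos_iff_eq_zero]
            refine (setLIntegral_congr_fun measurableSet_closedBall fun x hx => ?_).trans
              (lintegral_zero)
            refine Set.indicator_of_notMem (fun hxy => hy ?_) _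
            have := dist_triangle_left y z x
            rw [mem_closedBall] at hx ⊢
            have h2 : dist x y ≤ ρ := hxy
            linarith
      _ = A * V * volume (closedBall z (r + ρ)) := by
          rw [lintegral_indicator measurableSet_closedBall, setLIntegral_const]
      _ ≤ A * V * (2 ^ n * volume (closedBall z r)) := by
          gcongr
          rw [Real.volume_pi_closedBall _ hr0.le, Real.volume_pi_closedBall _ (by positivity),
            Fintype.card_fin, show (2 : ℝ≥0∞) ^ n = ENNReal.ofReal (2 ^ n) by
              rw [ENNReal.ofReal_pow (by norm_num), ENNReal.ofReal_ofNat],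
            ← ENNReal.ofReal_mul (by positivity), ← mul_pow]
          apply ENNReal.ofReal_le_ofReal
          exact pow_le_pow_left₀ (by positivity) (by linarith) n
      _ = _ := by ring
  exact (ENNReal.mul_le_mul_iff_left hV0 hVt).1 key

theorem cubeDev_le_of_forall_small {n : ℕ} {f : (Fin n → ℝ) → ℂ} (hf : LocallyIntegrable f)
    {ρ A : ℝ} (hρ : 0 < ρ) (h : ∀ y, cubeDev f 0 y ρ ≤ A) (z : Fin n → ℝ) {r : ℝ} (hr : ρ ≤ r) :
    cubeDev f 0 z r ≤ 2 ^ n * A := by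
  have hr0 : 0 < r := hρ.trans_le hr
  have hA : 0 ≤ A := (cubeDev_nonneg f 0 0 ρ).trans (h 0)
  have conv : ∀ (y : Fin n → ℝ) (s K : ℝ), 0 < s → 0 ≤ K → (cubeDev f 0 y s ≤ K ↔
      ∫⁻ x in Metric.closedBall y s, ‖f x‖ₑ ≤
        ENNReal.ofReal K * volume (Metric.closedBall y s)) := by
    intro y s K hs hK
    have h1 := ofReal_integral_eq_lintegral_ofReal (hf.integrableOn_norm_sub 0 y s)
      (Eventually.of_forall fun x => norm_nonneg _)
    simp only [ofReal_norm] at h1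
    simp only [sub_zero] at h1
    rw [← h1, Real.volume_pi_closedBall y hs.le, Fintype.card_fin, ← ENNReal.ofReal_mul hK,
      ENNReal.ofReal_le_ofReal_iff (by positivity)]
    have h2 := setIntegral_eq_mul_cubeDev f 0 y hs
    simp only [sub_zero] at h2
    rw [h2, mul_comm K, mul_le_mul_iff_right₀ (by positivity)]
  rw [conv z r _ hr0 (by positivity)]
  have := setLIntegral_closedBall_le_of_forall_small hf.aestronglyMeasurable.enorm hρ
    (fun y => (conv y ρ A hρ hA).1 (h y)) z hr
  rwa [ENNReal.ofReal_mul (by positivity), ENNReal.ofReal_pow (by norm_num), ENNReal.ofReal_ofNat]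

open Metric in
/-- Mollification at scale `ρ` stays within a mean deviation at scale `ρ` of any constant. -/
theorem norm_convolution_normed_sub_le {n : ℕ} {h : (Fin n → ℝ) → ℂ} (hh : LocallyIntegrable h)
    {ρ : ℝ} (hρ : 0 < ρ) (φ : ContDiffBump (0 : Fin n → ℝ)) (hin : φ.rIn = ρ / 2)
    (hout : φ.rOut = ρ) (c : ℂ) (x : Fin n → ℝ) :
    ‖convolution (φ.normed volume) h (ContinuousLinearMap.lsmul ℝ ℝ) volume x - c‖ ≤
      2 ^ n * cubeDev h c x ρ := by
  set Φ := φ.normed volume with hΦ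
  have hcont : Continuous fun t => Φ (x - t) := by
    have : Continuous Φ := φ.continuous_normed
    fun_prop
  have hzero : ∀ t, t ∉ closedBall x ρ → Φ (x - t) = 0 := by
    intro t ht
    by_contra hne
    have : x - t ∈ Function.support Φ := hne
    rw [hΦ, φ.support_normed_eq, hout, mem_ball, dist_zero_right, ← dist_eq_norm, dist_comm] at this
    exact ht this.le
  -- The bump is 1 on the ball of radius ρ/2, so its normalization is at most the reciprocal of that
  -- ball's volume.
  have hle : ∀ t, Φ (x - t) ≤ 2 ^ n * ((2 * ρ) ^ n)⁻¹ := by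
    intro t
    refine (φ.normed_le_div_measure_closedBall_rIn volume (x - t)).trans (le_of_eq ?_)
    rw [hin, volume_real_closedBall_pi _ (by positivity), ← inv_pow, ← mul_pow, one_div, ← inv_pow]
    congr 1
    field_simp
  have hsupp : ∀ g : (Fin n → ℝ) → ℂ, Function.support (fun t => Φ (x - t) • g t) ⊆
      closedBall x ρ := by
    intro g t ht
    by_contra hcon
    exact ht (by simp only [hzero t hcon, zero_smul])
  have hint : ∀ g : (Fin n → ℝ) → ℂ, LocallyIntegrable g → Integrable fun t => Φ (x - t) • g t := by
    intro g hg
    rw [← integrableOn_iff_integrable_of_support_subset (hsupp g)]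
    exact (hg.continuous_smul hcont).integrableOn_isCompact (isCompact_closedBall _ _)
  have hone : ∫ t, Φ (x - t) = 1 := by
    rw [integral_sub_left_eq_self Φ volume x]
    exact φ.integral_normed
  have e : convolution Φ h (ContinuousLinearMap.lsmul ℝ ℝ) volume x - c =
      ∫ t, Φ (x - t) • (h t - c) := by
    rw [convolution_lsmul_swap]
    simp_rw [smul_sub]
    rw [integral_sub (hint h hh) (hint _ (locallyIntegrable_const c)), integral_smul_const, hone,
      one_smul]
  rw [e]
  have hloc : LocallyIntegrable fun t => h t - c := hh.sub (locallyIntegrable_const c)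
  rw [← setIntegral_eq_integral_of_forall_compl_eq_zero (s := closedBall x ρ)
    fun t ht => by rw [hzero t ht, zero_smul]]
  refine (norm_integral_le_integral_norm _).trans ?_
  calc ∫ t in closedBall x ρ, ‖Φ (x - t) • (h t - c)‖
      ≤ ∫ t in closedBall x ρ, 2 ^ n * ((2 * ρ) ^ n)⁻¹ * ‖h t - c‖ := by
        refine setIntegral_mono_on (hint _ hloc).norm.integrableOn
          ((hh.integrableOn_norm_sub c x ρ).const_mul _) measurableSet_closedBall fun t _ => ?_
        rw [norm_smul, Real.norm_of_nonneg (φ.nonneg_normed _)]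
        gcongr
        exact hle t
    _ = _ := by
        rw [integral_const_mul, setIntegral_eq_mul_cubeDev h c x hρ]
        have : (2 * ρ) ^ n ≠ 0 := by positivity
        field_simp

open Metric in
/-- A compactly supported function with small oscillation on small cubes is close in BMO to a smooth
one of compact support. -/
theorem exists_contDiff_cubeOsc_sub_le {n : ℕ} {h : (Fin n → ℝ) → ℂ} (hh : LocallyIntegrable h)
    (hc : HasCompactSupport h) {ε δ : ℝ} (hδ : 0 < δ)
    (hosc : ∀ z r, 0 < r → r < δ → cubeOsc h z r ≤ ε) :
    ∃ g : (Fin n → ℝ) → ℂ, ContDiff ℝ ((⊤ : ℕ∞) : WithTop ℕ∞) g ∧ HasCompactSupport g ∧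
      ∀ z r, 0 < r → cubeOsc (h - g) z r ≤ 4 * 8 ^ n * ε := by
  set ρ := δ / 4 with hρdef
  have hρ : 0 < ρ := by positivity
  set φ : ContDiffBump (0 : Fin n → ℝ) := ⟨ρ / 2, ρ, by positivity, by linarith⟩ with hφ
  set g := convolution (φ.normed volume) h (ContinuousLinearMap.lsmul ℝ ℝ) volume with hg
  have hgd : ContDiff ℝ ((⊤ : ℕ∞) : WithTop ℕ∞) g :=
    φ.hasCompactSupport_normed.contDiff_convolution_left _ φ.contDiff_normed hh
  have hgc : HasCompactSupport g := φ.hasCompactSupport_normed.convolution _ hc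
  have hgl : LocallyIntegrable g := hgd.continuous.locallyIntegrable
  have hε : 0 ≤ ε := (cubeOsc_nonneg h 0 ρ).trans (hosc 0 ρ hρ (by linarith))
  -- One 2ⁿ comes from the kernel bound, the other from enlarging `closedBall x ρ` to `closedBall z
  -- (2ρ)`, whose radius δ/2 is still small.
  have hclose : ∀ z, ∀ x ∈ closedBall z ρ, ‖g x - cubeAvg h z (2 * ρ)‖ ≤ 4 ^ n * ε := by
    intro z x hx
    have h1 := norm_convolution_normed_sub_le hh hρ φ rfl rfl (cubeAvg h z (2 * ρ)) x
    have h2 : cubeDev h (cubeAvg h z (2 * ρ)) x ρ ≤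
        (2 * ρ / ρ) ^ n * cubeDev h (cubeAvg h z (2 * ρ)) z (2 * ρ) := by
      refine cubeDev_le_of_subset hh _ hρ (by positivity) (closedBall_subset_closedBall' ?_)
      rw [mem_closedBall] at hx
      linarith
    rw [mul_div_assoc, div_self hρ.ne', mul_one] at h2
    have h3 : cubeDev h (cubeAvg h z (2 * ρ)) z (2 * ρ) ≤ ε :=
      hosc z (2 * ρ) (by positivity) (by linarith)
    calc _ ≤ 2 ^ n * cubeDev h (cubeAvg h z (2 * ρ)) x ρ := h1
      _ ≤ 2 ^ n * (2 ^ n * ε) := by gcongr; exact h2.trans (by gcongr)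
      _ = 4 ^ n * ε := by rw [← mul_assoc, ← mul_pow]; norm_num
  have hpow2 : (1 : ℝ) ≤ 2 ^ n := one_le_pow₀ (by norm_num)
  have hpow24 : (2 : ℝ) ^ n ≤ 4 ^ n := pow_le_pow_left₀ (by norm_num) (by norm_num) n
  have hpow8 : (8 : ℝ) ^ n = 2 ^ n * 4 ^ n := by rw [← mul_pow]; norm_num
  have hpow48 : (4 : ℝ) ^ n ≤ 8 ^ n := pow_le_pow_left₀ (by norm_num) (by norm_num) n
  refine ⟨g, hgd, hgc, fun z r hr => ?_⟩
  rcases le_or_gt r ρ with hrρ | hrρ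
  · have h1 := hosc z r hr (by linarith)
    have h2 : cubeDev g (cubeAvg h z (2 * ρ)) z r ≤ 4 ^ n * ε :=
      cubeDev_le_of_forall_le hgl hr fun x hx => hclose z x (closedBall_subset_closedBall hrρ hx)
    have h3 := cubeDev_sub_le hh hgl (cubeAvg h z r) (cubeAvg h z (2 * ρ)) z hr
    have h8 := cubeOsc_le_two_mul_cubeDev (hh.sub hgl)
      (cubeAvg h z r - cubeAvg h z (2 * ρ)) z hr
    have h5 : cubeDev h (cubeAvg h z r) z r ≤ ε := h1
    have h6 : (4 : ℝ) ^ n * ε ≤ 8 ^ n * ε := by gcongr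
    have h7 : ε ≤ 8 ^ n * ε := le_mul_of_one_le_left hε (by linarith)
    linarith
  · have h1 : ∀ y, cubeDev (h - g) 0 y ρ ≤ 2 * 4 ^ n * ε := by
      intro y
      have h2 : cubeDev g (cubeAvg h y (2 * ρ)) y ρ ≤ 4 ^ n * ε :=
        cubeDev_le_of_forall_le hgl hρ fun x hx => hclose y x hx
      have h3 := cubeDev_sub_le hh hgl (cubeAvg h y (2 * ρ)) (cubeAvg h y (2 * ρ)) y hρ
      rw [sub_self] at h3
      have h5 : cubeDev h (cubeAvg h y (2 * ρ)) y ρ ≤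
          (2 * ρ / ρ) ^ n * cubeDev h (cubeAvg h y (2 * ρ)) y (2 * ρ) :=
        cubeDev_le_of_subset hh _ hρ (by positivity) (closedBall_subset_closedBall (by linarith))
      rw [mul_div_assoc, div_self hρ.ne', mul_one] at h5
      have h6 : cubeDev h (cubeAvg h y (2 * ρ)) y (2 * ρ) ≤ ε :=
        hosc y (2 * ρ) (by positivity) (by linarith)
      have h7 : (2 : ℝ) ^ n * cubeDev h (cubeAvg h y (2 * ρ)) y (2 * ρ) ≤ 4 ^ n * ε :=
        mul_le_mul hpow24 h6 (cubeDev_nonneg _ _ _ _) (by positivity)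
      linarith
    have h2 := cubeDev_le_of_forall_small (hh.sub hgl) hρ h1 z hrρ.le
    refine (cubeOsc_le_two_mul_cubeDev (hh.sub hgl) 0 z hr).trans ?_
    rw [hpow8]
    linarith

/-! ### The limit conditions in ε-δ form. -/

open Metric in
theorem closedBall_zero_pi_eq_Icc {n : ℕ} {d : ℝ} (hd : 0 ≤ d) :
    closedBall (0 : Fin n → ℝ) d = Set.Icc (fun _ => -d) (fun _ => d) := by
  rw [closedBall_pi _ hd, ← Set.pi_univ_Icc]
  simp only [Real.closedBall_eq_Icc, Pi.zero_apply, zero_sub, zero_add]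

open Metric in
/-- The three limit conditions on a functional of cubes, in `ε`-`δ` form. -/
theorem tendsto_iff_vanishesOnExtremeCubes {n : ℕ} (hn : 1 ≤ n) (A : Set (Fin n → ℝ) → ℝ≥0∞) :
    ((Tendsto (fun r : ℝ => ⨆ (Q : Set (Fin n → ℝ)) (_ : IsCube Q)
          (_ : volume Q = ENNReal.ofReal r), A Q) (𝓝[>] 0) (𝓝 0)) ∧
      (Tendsto (fun r : ℝ => ⨆ (Q : Set (Fin n → ℝ)) (_ : IsCube Q)
          (_ : volume Q = ENNReal.ofReal r), A Q) atTop (𝓝 0)) ∧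
      (Tendsto (fun d : ℝ => ⨆ (Q : Set (Fin n → ℝ)) (_ : IsCube Q)
          (_ : Q ∩ Set.Icc (fun _ => -d) (fun _ => d) = ∅), A Q)
        atTop (𝓝 0))) ↔ VanishesOnExtremeCubes fun z r => A (closedBall z r) := by
  have hvol : ∀ (z : Fin n → ℝ) (r : ℝ), 0 < r →
      volume (closedBall z r) = ENNReal.ofReal ((2 * r) ^ n) := fun z r hr => by
    rw [Real.volume_pi_closedBall z hr.le, Fintype.card_fin]
  simp only [ENNReal.tendsto_nhds_zero]
  constructor
  · rintro ⟨h1, h2, h3⟩ ε hε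
    have hε' : (0 : ℝ≥0∞) < ENNReal.ofReal ε := ENNReal.ofReal_pos.2 hε
    obtain ⟨r₀, hr₀, h1⟩ := mem_nhdsGT_iff_exists_Ioo_subset.1 (h1 _ hε')
    obtain ⟨R₀, h2⟩ := eventually_atTop.1 (h2 _ hε')
    obtain ⟨d₀, h3⟩ := eventually_atTop.1 (h3 _ hε')
    have hr₀' : (0 : ℝ) < r₀ := hr₀
    -- The limits are indexed by volume (2r)ⁿ, not radius. The comparisons with 1 give (2r)ⁿ ≤ 2r
    -- for small cubes and 2r ≤ (2r)ⁿ for large ones.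
    refine ⟨min 1 r₀ / 2, max 1 R₀, max 1 d₀, by positivity, by positivity, by positivity,
      fun z r hr hzr => ?_⟩
    have hQ : IsCube (closedBall z r) := isCube_iff_exists_closedBall.2 ⟨z, r, hr, rfl⟩
    rcases hzr with h | h | h
    · have ha := min_le_left 1 r₀
      have hb := min_le_right 1 r₀
      have hc : (2 * r) ^ n ≤ 2 * r := pow_le_of_le_one (by positivity) (by linarith) (by omega)
      have hmem : (2 * r) ^ n ∈ Set.Ioo 0 r₀ := ⟨by positivity, by linarith⟩
      have hsup : (⨆ (Q : Set (Fin n → ℝ)) (_ : IsCube Q)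
        (_ : volume Q = ENNReal.ofReal ((2 * r) ^ n)), A Q) ≤ ENNReal.ofReal ε := h1 hmem
      simp only [iSup_le_iff] at hsup
      exact hsup _ hQ (hvol z r hr)
    · have ha := le_max_left 1 R₀
      have hb := le_max_right 1 R₀
      have hc : 2 * r ≤ (2 * r) ^ n := le_self_pow₀ (by linarith) (by omega)
      have hsup : (⨆ (Q : Set (Fin n → ℝ)) (_ : IsCube Q)
        (_ : volume Q = ENNReal.ofReal ((2 * r) ^ n)), A Q) ≤ ENNReal.ofReal ε := h2 _ (by linarith)
      simp only [iSup_le_iff] at hsup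
      exact hsup _ hQ (hvol z r hr)
    · rw [closedBall_zero_pi_eq_Icc (by positivity), Set.disjoint_iff_inter_eq_empty] at h
      have hsup : (⨆ (Q : Set (Fin n → ℝ)) (_ : IsCube Q)
        (_ : Q ∩ Set.Icc (fun _ => -(max 1 d₀)) (fun _ => max 1 d₀) = ∅), A Q) ≤ ENNReal.ofReal ε := 
        h3 _ (le_max_right _ _)
      simp only [iSup_le_iff] at hsup
      exact hsup _ hQ h
  · intro h
    have key : ∀ ε : ℝ≥0∞, 0 < ε → ∃ δ R d : ℝ, 0 < δ ∧ 0 < R ∧ 0 < d ∧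
        ∀ z r, 0 < r → IsExtremeCube δ R d z r → A (closedBall z r) ≤ ε := by
      intro ε hε
      rcases eq_or_ne ε ⊤ with rfl | hε'
      · exact ⟨1, 1, 1, one_pos, one_pos, one_pos, fun _ _ _ _ => le_top⟩
      · obtain ⟨δ, R, d, hδ, hR, hd, hA⟩ := h ε.toReal (ENNReal.toReal_pos hε.ne' hε')
        rw [ENNReal.ofReal_toReal hε'] at hA
        exact ⟨δ, R, d, hδ, hR, hd, hA⟩
    refine ⟨fun ε hε => ?_, fun ε hε => ?_, fun ε hε => ?_⟩
    · obtain ⟨δ, R, d, hδ, hR, hd, hA⟩ := key ε hε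
      filter_upwards [Ioo_mem_nhdsGT (show (0 : ℝ) < (2 * δ) ^ n by positivity)] with v hv
      refine iSup_le fun Q => iSup_le fun hQ => iSup_le fun hQv => ?_
      obtain ⟨z, r, hr, rfl⟩ := isCube_iff_exists_closedBall.1 hQ
      rw [hvol z r hr, ENNReal.ofReal_eq_ofReal_iff (by positivity) hv.1.le] at hQv
      refine hA z r hr (Or.inl ?_)
      have := (pow_lt_pow_iff_left₀ (by positivity) (by positivity) (by omega)).1 (hQv ▸ hv.2)
      linarith
    · obtain ⟨δ, R, d, hδ, hR, hd, hA⟩ := key ε hε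
      have hpos : 0 < (2 * R) ^ n := by positivity
      filter_upwards [eventually_gt_atTop ((2 * R) ^ n)] with v hv
      refine iSup_le fun Q => iSup_le fun hQ => iSup_le fun hQv => ?_
      obtain ⟨z, r, hr, rfl⟩ := isCube_iff_exists_closedBall.1 hQ
      rw [hvol z r hr, ENNReal.ofReal_eq_ofReal_iff (by positivity) (hpos.trans hv).le] at hQv
      refine hA z r hr (Or.inr (Or.inl ?_))
      have := (pow_lt_pow_iff_left₀ (by positivity) (by positivity) (by omega)).1 (hQv ▸ hv)
      linarith
    · obtain ⟨δ, R, d, hδ, hR, hd, hA⟩ := key ε hε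
      filter_upwards [eventually_ge_atTop d] with v hv
      refine iSup_le fun Q => iSup_le fun hQ => iSup_le fun hQv => ?_
      obtain ⟨z, r, hr, rfl⟩ := isCube_iff_exists_closedBall.1 hQ
      rw [← closedBall_zero_pi_eq_Icc (hd.le.trans hv), ← Set.disjoint_iff_inter_eq_empty] at hQv
      exact hA z r hr (Or.inr (Or.inr (hQv.mono_right (closedBall_subset_closedBall hv))))

/-! ### Necessity, sufficiency and conclusion. -/

open Metric in
theorem localMeanOscillation_le_of_cubeOsc_lt {n : ℕ} {f : (Fin n → ℝ) → ℂ}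
    (hf : LocallyIntegrable f) {z : Fin n → ℝ} {r : ℝ} (hr : 0 < r) {lam α : ℝ} (hα : 0 < α)
    (h : cubeOsc f z r < lam * α) :
    localMeanOscillation lam f (closedBall z r) ≤ ENNReal.ofReal α := by
  refine iInf_le_of_le (cubeAvg f z r) (sInf_le ⟨ENNReal.ofReal_pos.2 hα, ?_⟩)
  refine lt_of_le_of_lt (measure_mono ?_) (measure_lt_of_cubeDev_lt hf hr hα h)
  intro x hx
  change ENNReal.ofReal α < ‖(closedBall z r).indicator (fun x => f x - cubeAvg f z r) x‖ₑ at hx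
  by_cases hxz : x ∈ closedBall z r
  · rw [Set.indicator_of_mem hxz, ← ofReal_norm] at hx
    exact ⟨hxz, (ENNReal.ofReal_lt_ofReal_iff_of_nonneg hα.le).1 hx⟩
  · rw [Set.indicator_of_notMem hxz, enorm_zero] at hx
    exact absurd hx (by simp)

open Metric in
-- Uniform continuity handles small cubes, the bound ‖g‖₁/|Q| large ones, and the support distant
-- ones.
theorem Continuous.vanishesOnExtremeCubes_cubeOsc {n : ℕ} (hn : 1 ≤ n) {g : (Fin n → ℝ) → ℂ}
    (hg : Continuous g) (hc : HasCompactSupport g) :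
    VanishesOnExtremeCubes fun z r => ENNReal.ofReal (cubeOsc g z r) := by
  intro ε hε
  have hgl : LocallyIntegrable g := hg.locallyIntegrable
  obtain ⟨δ, hδ, hu⟩ := Metric.uniformContinuous_iff.1 (hc.uniformContinuous_of_continuous hg)
    (ε / 2) (by positivity)
  obtain ⟨d, hd0, hd⟩ : ∃ d, 0 < d ∧ tsupport g ⊆ closedBall 0 d := by
    obtain ⟨d, hd⟩ := hc.isCompact.isBounded.subset_closedBall (0 : Fin n → ℝ)
    exact ⟨max 1 d, by positivity, hd.trans (closedBall_subset_closedBall (le_max_right _ _))⟩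
  set I := ∫ x, ‖g x‖ with hI
  have hI0 : 0 ≤ I := integral_nonneg fun x => norm_nonneg _
  refine ⟨δ, max 1 (I / ε), d, hδ, by positivity, hd0,
    fun z r hr hzr => ENNReal.ofReal_le_ofReal ?_⟩
  rcases hzr with h | h | h
  · have h1 : cubeDev g (g z) z r ≤ ε / 2 := cubeDev_le_of_forall_le hgl hr fun x hx => by
      rw [← dist_eq_norm]
      exact (hu (lt_of_le_of_lt hx h)).le
    linarith [cubeOsc_le_two_mul_cubeDev hgl (g z) z hr]
  · have h1 : cubeDev g 0 z r ≤ ε / 2 := by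
      rw [cubeDev_eq _ _ _ hr.le, inv_mul_le_iff₀ (by positivity)]
      simp only [sub_zero]
      have h2 : ∫ x in closedBall z r, ‖g x‖ ≤ I :=
        setIntegral_le_integral (hg.integrable_of_hasCompactSupport hc).norm
          (Eventually.of_forall fun x => norm_nonneg _)
      have h3 := (le_max_left _ _).trans_lt h
      have h4 := (le_max_right _ _).trans_lt h
      rw [div_lt_iff₀ hε] at h4
      have h5 : 2 * r ≤ (2 * r) ^ n := le_self_pow₀ (by linarith) (by omega)
      have h6 : 2 * r * (ε / 2) ≤ (2 * r) ^ n * (ε / 2) := by gcongr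
      linarith
    linarith [cubeOsc_le_two_mul_cubeDev hgl 0 z hr]
  · have h1 : cubeDev g 0 z r ≤ 0 := cubeDev_le_of_forall_le hgl hr fun x hx => by
      rw [image_eq_zero_of_notMem_tsupport fun hxt => Set.disjoint_left.1 h hx (hd hxt), sub_zero,
        norm_zero]
    linarith [cubeOsc_le_two_mul_cubeDev hgl 0 z hr]

theorem MemCMO.vanishesOnExtremeCubes_cubeOsc {n : ℕ} (hn : 1 ≤ n) {f : (Fin n → ℝ) → ℂ}
    (hf : MemCMO f) : VanishesOnExtremeCubes fun z r => ENNReal.ofReal (cubeOsc f z r) := by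
  intro ε hε
  obtain ⟨g, hgd, hgc, hfg⟩ := hf.2 (ENNReal.ofReal (ε / 2)) (ENNReal.ofReal_pos.2 (by positivity))
  obtain ⟨δ, R, d, hδ, hR, hd, hg⟩ :=
    hgd.continuous.vanishesOnExtremeCubes_cubeOsc hn hgc (ε / 2) (by positivity)
  have hgl : LocallyIntegrable g := hgd.continuous.locallyIntegrable
  have hfgl := hf.1.1.sub hgl
  refine ⟨δ, R, d, hδ, hR, hd, fun z r hr hzr => ?_⟩
  have h1 := hg z r hr hzr
  have h2 := (ofReal_cubeOsc_le_bmoSeminorm hfgl z hr).trans hfg.le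
  have h3 := cubeOsc_add_le hfgl hgl z hr
  rw [sub_add_cancel] at h3
  calc ENNReal.ofReal (cubeOsc f z r)
      ≤ ENNReal.ofReal (cubeOsc (f - g) z r) + ENNReal.ofReal (cubeOsc g z r) := by
        rw [← ENNReal.ofReal_add (cubeOsc_nonneg _ _ _) (cubeOsc_nonneg _ _ _)]
        exact ENNReal.ofReal_le_ofReal h3
    _ ≤ ENNReal.ofReal (ε / 2) + ENNReal.ofReal (ε / 2) := add_le_add h2 h1
    _ = ENNReal.ofReal ε := by
        rw [← ENNReal.ofReal_add (by positivity) (by positivity), add_halves]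

/-- Uchiyama's characterization of `CMO`, sufficiency. -/
theorem MemBMO.memCMO_of_vanishesOnExtremeCubes {n : ℕ} {f : (Fin n → ℝ) → ℂ} (hf : MemBMO f)
    (h : VanishesOnExtremeCubes fun z r => ENNReal.ofReal (cubeOsc f z r)) : MemCMO f := by
  refine ⟨hf, fun ε hε => ?_⟩
  obtain ⟨η, hη, hηε⟩ : ∃ η : ℝ, 0 < η ∧ ENNReal.ofReal η < ε := by
    obtain ⟨η, -, h1, h2⟩ := ENNReal.lt_iff_exists_real_btwn.1 hε
    exact ⟨η, ENNReal.ofReal_pos.1 h1, h2⟩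
  -- `C` is the cutoff loss. The truncation `k = f - (f - k)` oscillates at most (1 + C)ε' on small
  -- cubes, and mollifying it costs a further factor 4·8ⁿ.
  set C : ℝ := 2 * (1 + 4 * 4 ^ n + 12 ^ n) with hC
  set C' : ℝ := C + 4 * 8 ^ n * (1 + C) with hC'
  have hC0 : 0 < C := by positivity
  have hC'0 : 0 < C' := by positivity
  set ε' := η / C' with hε'
  have hε'0 : 0 < ε' := by positivity
  obtain ⟨δ, R, d, hδ, hR, hd, hext⟩ := h ε' hε'0
  have hosc : ∀ z r, 0 < r → IsExtremeCube δ R d z r → cubeOsc f z r ≤ ε' := fun z r hr hzr =>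
    (ENNReal.ofReal_le_ofReal_iff hε'0.le).1 (hext z r hr hzr)
  obtain ⟨k, hk, hkc, hfk⟩ := exists_hasCompactSupport_cubeOsc_sub_le hf.1 hR hd
    fun z r hr hzr => hosc z r hr (Or.inr hzr)
  obtain ⟨g, hgd, hgc, hkg⟩ := exists_contDiff_cubeOsc_sub_le hk hkc (ε := (1 + C) * ε') hδ
    fun z r hr hrδ => by
      have h1 := cubeOsc_sub_le hf.1 (hf.1.sub hk) z hr
      rw [sub_sub_cancel] at h1
      have h2 := hosc z r hr (Or.inl hrδ)
      have h3 := hfk z r hr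
      linarith
  have hgl : LocallyIntegrable g := hgd.continuous.locallyIntegrable
  refine ⟨g, hgd, hgc, lt_of_le_of_lt (bmoSeminorm_le_ofReal (hf.1.sub hgl) fun z r hr => ?_) hηε⟩
  have h1 := cubeOsc_add_le (hf.1.sub hk) (hk.sub hgl) z hr
  rw [sub_add_sub_cancel] at h1
  have h2 := hfk z r hr
  have h3 := hkg z r hr
  have h4 : η = C' * ε' := by rw [hε']; field_simp
  rw [h4, hC']
  linarith

theorem theorem3p3 (n : ℕ) (hn : 1 ≤ n) (lam : ℝ) (hlam0 : 0 < lam) (hlam : lam ≤ 1 / 2)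
    (f : (Fin n → ℝ) → ℂ) (hf : MemBMO f) :
    MemCMO f ↔
      (Tendsto (fun r : ℝ => ⨆ (Q : Set (Fin n → ℝ)) (_ : IsCube Q)
          (_ : volume Q = ENNReal.ofReal r), localMeanOscillation lam f Q) (𝓝[>] 0) (𝓝 0)) ∧
      (Tendsto (fun r : ℝ => ⨆ (Q : Set (Fin n → ℝ)) (_ : IsCube Q)
          (_ : volume Q = ENNReal.ofReal r), localMeanOscillation lam f Q) atTop (𝓝 0)) ∧
      (Tendsto (fun d : ℝ => ⨆ (Q : Set (Fin n → ℝ)) (_ : IsCube Q)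
          (_ : Q ∩ Set.Icc (fun _ => -d) (fun _ => d) = ∅), localMeanOscillation lam f Q)
        atTop (𝓝 0)) := by
  rw [tendsto_iff_vanishesOnExtremeCubes hn (localMeanOscillation lam f)]
  constructor
  -- The factor 1/2 in lam·ε/2 provides the strict inequality that Chebyshev's bound requires.
  · intro h ε hε
    obtain ⟨δ, R, d, hδ, hR, hd, hosc⟩ :=
      h.vanishesOnExtremeCubes_cubeOsc hn (lam * ε / 2) (by positivity)
    refine ⟨δ, R, d, hδ, hR, hd, fun z r hr hzr =>
      localMeanOscillation_le_of_cubeOsc_lt hf.1 hr hε ?_⟩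
    have h1 := (ENNReal.ofReal_le_ofReal_iff (by positivity)).1 (hosc z r hr hzr)
    have h2 : 0 < lam * ε := by positivity
    linarith
  · intro h
    exact hf.memCMO_of_vanishesOnExtremeCubes (vanishesOnExtremeCubes_cubeOsc hn hlam hf h)
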